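/- For a finite set $\mathcal{H}\subseteq\mathbb{Z}$ and a prime $p$, let $$\delta_{\mathcal{H}}(p)=\lim_{\alpha\to\infty}\frac{\#\{0\le a<p^{\alpha} : \text{for every } h\in\mathcal{H},\ a+h \text{ is congruent to a sum of two squares modulo } p^{\alpha}\}}{p^{\alpha}},$$ and define the singular series for sums of two squares by $$\mathfrak{S}(\mathcal{H})=\prod_{p\not\equiv 1 \ (\mathrm{mod}\ 4)}\frac{\delta_{\mathcal{H}}(p)}{\delta_{\{0\}}(p)^{|\mathcal{H}|}},$$ the product being over the primes $p\not\equiv 1 \pmod 4$ (so $p=2$ is included). Put $$\mathfrak{S}_0(\mathcal{H})=\sum_{\mathcal{T}\subseteq\mathcal{H}}(-1)^{|\mathcal{H}\setminus\mathcal{T}|}\,\mathfrak{S}(\mathcal{T}).$$ Then the limits defining $\delta_{\mathcal{H}}(p)$ exist, the products defining $\mathfrak{S}(\mathcal{H})$ converge unconditionally (possibly to $0$), and for every integer $k\ge 1$ and every real $\varepsilon>0$ there is a constant $C>0$, depending only on $k$ and $\varepsilon$, such that for every integer $h\ge 1$, $$\Bigg|\sum_{\substack{\mathcal{H}\subseteq\{1,\dots,h\}\\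 |\mathcal{H}|=k}}\mathfrak{S}_0(\mathcal{H})\Bigg|\le C\,h^{\frac{k}{2}+\varepsilon}.$$ -/

import Mathlib

noncomputable section

namespace SumTwoSquares

open Filter Topology

/-- The residues `0 ≤ a < p ^ α` such that, for every `h ∈ H`, the integer `a + h` is congruent to
a sum of two squares modulo `p ^ α`. -/
def goodResidues (H : Finset ℤ) (p α : ℕ) : Set ℕ :=
  {a | a < p ^ α ∧ ∀ h ∈ H, ∃ x y : ℤ, (a : ℤ) + h ≡ x ^ 2 + y ^ 2 [ZMOD ((p ^ α : ℕ) : ℤ)]}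

/-- The proportion of residues modulo `p ^ α` all of whose shifts by `H` are sums of two squares
modulo `p ^ α`. -/
def densityMod (H : Finset ℤ) (p α : ℕ) : ℝ :=
  ((goodResidues H p α).ncard : ℝ) / (p : ℝ) ^ α

/-- The local density `δ_H(p)`, the limit of `densityMod H p α` as `α → ∞`. -/
def localDensity (H : Finset ℤ) (p : ℕ) : ℝ :=
  limUnder atTop (fun α : ℕ => densityMod H p α)

/-- The primes `p ≢ 1 (mod 4)`, that is `2` and the primes `p ≡ 3 (mod 4)`. -/
abbrev PrimeNotOneModFour : Type := {p : ℕ // p.Prime ∧ ¬ p ≡ 1 [MOD 4]}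

/-- The Euler factor `δ_H(p) / δ_{0}(p) ^ |H|`. -/
def eulerFactor (H : Finset ℤ) (p : ℕ) : ℝ :=
  localDensity H p / localDensity {0} p ^ H.card

/-- The singular series `𝔖(H) = ∏_{p ≢ 1 (mod 4)} δ_H(p) / δ_{0}(p) ^ |H|`. -/
def singularSeries (H : Finset ℤ) : ℝ :=
  ∏' p : PrimeNotOneModFour, eulerFactor H p

/-- `𝔖₀(H) = ∑_{T ⊆ H} (-1) ^ |H ∖ T| 𝔖(T)`. -/
def singularSeries₀ (H : Finset ℤ) : ℝ :=
  ∑ T ∈ H.powerset, (-1 : ℝ) ^ (H \ T).card * singularSeries T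

end SumTwoSquares

end

/-!
Write `F_p` for the indicator function of the sums of two squares modulo `p ^ α`, divided by its
mean, and `F = ∏ F_p` over the primes `p ≤ y`, `p ≢ 1 (mod 4)`. By the Chinese remainder theorem
the singular series of `T`, truncated at `y` and at level `α`, is the mean value over `x` of
`∏ F (x + t)`, `t ∈ T`. Expanding a product of differences, the sum of `𝔖₀` over the `k`-subsets of
`{1, …, h}` becomes the mean value of the `k`-th elementary symmetric function of
`F (x + 1) - 1, …, F (x + h) - 1`. Euler factors at `p > h` are `1 + O(1 / p²)`, so the truncation
at `y ≈ h ^ k` costs only `O(h ^ ε)`; with that choice of `y` all Euler products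
`∏ (1 + c / p)`, `p ≤ y`, are `O(h ^ ε)` as well (`exists_prod_one_add_div_le`, from the upper bound
in Mertens' first theorem).

Newton's identities (`abs_sum_powersetCard_le`) bound the elementary symmetric function by the
`k`-th power of the first power sum `∑ (F (x + n) - 1)` and of `√h · ∏ (1 + 6 / p)`, which takes
care of the power sums of exponent at least `2`. So what is needed is an even moment of the first
power sum with square root cancellation, up to Euler products (`exists_moment_le`).

This follows the method of Montgomery and Vaughan for reduced residues, carried out without Fourier
analysis. Each `F_p` splits into its martingale differences with respect to the residue modulo
`p ^ j` (`levelPart`), so that `F - 1` is the sum over `q > 1` of components `g_q` of period `q`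
whose averages over the cosets of each subgroup of prime order of `ℤ/q` vanish (`IsPrimitive`) and
which satisfy `|g_q x| ≤ 16 ^ ω(q) gcd (x, q) / q`. The last bound rests on two facts: for odd `p`
whether `p ^ v * u`, `p ∤ u`, is a sum of two squares modulo `p ^ α` does not depend on `u`, and for
`p = 2` it depends only on `u` modulo `4`. Let `A_q` be the sum of `g_q` over `x + 1, …, x + h`.
* Complete periods contribute nothing to `A_q`, so its mean square is `≪ h / q`, up to divisor
  functions (`IsPrimitive.sum_sq_shiftSum_le`).
* The mean value of `∏ A_{q_i}` vanishes unless every prime power dividing `r = lcm q_i` divides at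
  least two of the `q_i` (`sum_prod_eq_zero`).
* In the remaining case it is at most `r⁻¹ ∏ (∑_{x mod q_i} A_{q_i}(x)²)^{1/2}`, by an inequality of
  Hölder type proved one prime at a time (`sum_prod_le_prod_sqrt`).
Summing over all `q_i` gives `h ^ (m / 2)` times an Euler product `∏ (1 + C / p)` for the `m`-th
moment.
-/

namespace SumTwoSquares

open Finset Function

/-! ### Sums of periodic functions over complete residue systems -/

theorem periodic_of_dvd {f : ℤ → ℝ} {q r : ℕ} (hf : Periodic f (q : ℤ)) (h : q ∣ r) :
    Periodic f (r : ℤ) := by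
  obtain ⟨c, rfl⟩ := h
  have := hf.nat_mul c
  intro x
  have h2 := this x
  rw [← h2]; congr 1; push_cast; ring

theorem eq_of_dvd_sub {f : ℤ → ℝ} {q : ℕ} (hf : Periodic f (q : ℤ)) {x y : ℤ}
    (h : (q : ℤ) ∣ x - y) : f x = f y := by
  obtain ⟨c, hc⟩ := h
  have := hf.int_mul c y
  rw [← this]; congr 1; push_cast; linarith

/-- A periodic function may be summed over any complete system of residues. -/
theorem sum_eq_of_injOn {f : ℤ → ℝ} {q : ℕ} (hq : 0 < q) (hf : Periodic f (q : ℤ))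
    {ι : Type*} (s : Finset ι) (t : ι → ℤ) (hcard : s.card = q)
    (hinj : ∀ i ∈ s, ∀ j ∈ s, (q : ℤ) ∣ t i - t j → i = j) :
    ∑ i ∈ s, f (t i) = ∑ x ∈ range q, f x := by
  classical
  have hq' : (0 : ℤ) < q := by exact_mod_cast hq
  set e : ι → ℕ := fun i => (t i % q).toNat with he
  have hcast : ∀ i, ((e i : ℕ) : ℤ) = t i % q := fun i =>
    Int.toNat_of_nonneg (Int.emod_nonneg _ hq'.ne')
  have hdvd : ∀ i, (q : ℤ) ∣ t i - e i := fun i => by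
    rw [hcast]; exact Int.dvd_self_sub_emod
  have hinj' : Set.InjOn e (s : Set ι) := by
    intro i hi j hj hij
    apply hinj i hi j hj
    have := dvd_sub (hdvd i) (hdvd j)
    rw [hij] at this
    simpa using this
  have himg : s.image e = range q := by
    apply Finset.eq_of_subset_of_card_le
    · intro x hx
      obtain ⟨i, _, rfl⟩ := Finset.mem_image.1 hx
      rw [Finset.mem_range]
      have := Int.emod_lt_of_pos (t i) hq'
      rw [← hcast] at this
      exact_mod_cast this
    · rw [Finset.card_image_of_injOn hinj', hcard, card_range]
  rw [← himg, Finset.sum_image hinj']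
  exact Finset.sum_congr rfl fun i _ => eq_of_dvd_sub hf (hdvd i)

theorem eq_of_dvd_sub_of_lt {q x y : ℕ} (hx : x < q) (hy : y < q)
    (h : (q : ℤ) ∣ (x : ℤ) - y) : x = y := by
  have h1 : (x : ℤ) - y = 0 := Int.eq_zero_of_abs_lt_dvd h (by rw [abs_lt]; constructor <;> omega)
  omega

theorem sum_range_add {f : ℤ → ℝ} {q : ℕ} (hf : Periodic f (q : ℤ)) (a : ℤ) :
    ∑ x ∈ range q, f (x + a) = ∑ x ∈ range q, f x := by
  rcases Nat.eq_zero_or_pos q with rfl | hq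
  · simp
  apply sum_eq_of_injOn hq hf (range q) (fun x => (x : ℤ) + a) (card_range q)
  intro i hi j hj h
  apply eq_of_dvd_sub_of_lt (mem_range.1 hi) (mem_range.1 hj)
  simpa using h

theorem sum_range_add_mul {f : ℤ → ℝ} {q : ℕ} (hf : Periodic f (q : ℤ)) (a c : ℤ)
    (hc : IsCoprime (q : ℤ) c) :
    ∑ x ∈ range q, f (a + c * x) = ∑ x ∈ range q, f x := by
  rcases Nat.eq_zero_or_pos q with rfl | hq
  · simp
  apply sum_eq_of_injOn hq hf (range q) (fun x => a + c * x) (card_range q)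
  intro i hi j hj h
  apply eq_of_dvd_sub_of_lt (mem_range.1 hi) (mem_range.1 hj)
  have h2 : (q : ℤ) ∣ c * ((i : ℤ) - j) := by convert h using 1; ring
  exact hc.dvd_of_dvd_mul_left h2

theorem sum_range_mul {f : ℤ → ℝ} {q : ℕ} (hf : Periodic f (q : ℤ)) (k : ℕ) :
    ∑ x ∈ range (q * k), f x = k * ∑ x ∈ range q, f x := by
  induction k with
  | zero => simp
  | succ k ih =>
    rw [Nat.mul_succ, Finset.sum_range_add, ih]
    have : ∑ x ∈ range q, f ((q * k + x : ℕ) : ℤ) = ∑ x ∈ range q, f x := by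
      refine Finset.sum_congr rfl fun x _ => eq_of_dvd_sub hf ⟨k, ?_⟩
      push_cast; ring
    rw [this]; push_cast; ring

/-- The Chinese remainder theorem for sums over a complete period. -/
theorem sum_range_crt {f : ℤ → ℝ} {m n : ℕ} (hmn : m.Coprime n)
    (hf : Periodic f ((m * n : ℕ) : ℤ)) {a b : ℕ} (ha : m.Coprime a) (hb : n.Coprime b) :
    ∑ u ∈ range m, ∑ v ∈ range n, f ((n * a : ℕ) * u + (m * b : ℕ) * v) =
      ∑ x ∈ range (m * n), f x := by
  rcases Nat.eq_zero_or_pos (m * n) with h0 | hq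
  · rcases Nat.mul_eq_zero.1 h0 with rfl | rfl <;> simp
  rw [← Finset.sum_product']
  apply sum_eq_of_injOn hq hf (range m ×ˢ range n)
    (fun z : ℕ × ℕ => ((n * a : ℕ) : ℤ) * (z.1 : ℤ) + ((m * b : ℕ) : ℤ) * (z.2 : ℤ)) (by simp)
  rintro ⟨u, v⟩ h1 ⟨u', v'⟩ h2 h
  simp only [mem_product, mem_range] at h1 h2
  push_cast at h
  obtain ⟨c, hc⟩ := h
  have hm : (m : ℤ) ∣ (n * a : ℤ) * ((u : ℤ) - u') :=
    ⟨n * c - b * ((v : ℤ) - v'), by linear_combination hc⟩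
  have hn : (n : ℤ) ∣ (m * b : ℤ) * ((v : ℤ) - v') :=
    ⟨m * c - a * ((u : ℤ) - u'), by linear_combination hc⟩
  have c1 : IsCoprime (m : ℤ) (n * a : ℤ) := by
    exact_mod_cast Nat.isCoprime_iff_coprime.2 (hmn.mul_right ha)
  have c2 : IsCoprime (n : ℤ) (m * b : ℤ) := by
    exact_mod_cast Nat.isCoprime_iff_coprime.2 (hmn.symm.mul_right hb)
  rw [Prod.mk.injEq]
  exact ⟨eq_of_dvd_sub_of_lt h1.1 h2.1 (c1.dvd_of_dvd_mul_left hm),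
    eq_of_dvd_sub_of_lt h1.2 h2.2 (c2.dvd_of_dvd_mul_left hn)⟩

/-! ### An inequality for products of functions periodic to different levels -/

/-- The substitution `x = B u + A v`, with `A`, `B` the moduli of a larger system: it serves all the
levels `m n ∣ A B` at once. -/
theorem sum_range_crt_of_dvd {f : ℤ → ℝ} {A B m n : ℕ} (hAB : A.Coprime B) (hA : 0 < A)
    (hB : 0 < B) (hm : m ∣ A) (hn : n ∣ B) (hf : Periodic f ((m * n : ℕ) : ℤ)) :
    ∑ v ∈ range n, ∑ u ∈ range m, f ((B : ℤ) * u + (A : ℤ) * v) =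
      ∑ x ∈ range (m * n), f x := by
  obtain ⟨a, rfl⟩ := hm
  obtain ⟨b, rfl⟩ := hn
  rw [Finset.sum_comm]
  exact sum_range_crt (hAB.coprime_mul_right.coprime_mul_right_right) hf
    (hAB.coprime_mul_right.coprime_mul_left_right)
    (hAB.coprime_mul_left.coprime_mul_right_right).symm

theorem le_sqrt_sum_sq {f : ℤ → ℝ} {q : ℕ} (hq : 0 < q) (hf : Periodic f (q : ℤ))
    (x : ℤ) : f x ≤ √(∑ y ∈ range q, f y ^ 2) := by
  have hq' : (0 : ℤ) < q := by exact_mod_cast hq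
  have hcast : (((x % q).toNat : ℕ) : ℤ) = x % q :=
    Int.toNat_of_nonneg (Int.emod_nonneg _ hq'.ne')
  have hx : f x = f ((x % q).toNat : ℕ) := by
    refine eq_of_dvd_sub hf ?_
    rw [hcast]; exact Int.dvd_self_sub_emod
  refine Real.le_sqrt_of_sq_le ?_
  rw [hx]
  refine Finset.single_le_sum (f := fun y : ℕ => f y ^ 2) (fun _ _ => sq_nonneg _) ?_
  have := Int.emod_lt_of_pos x hq'
  rw [mem_range]; omega

/-- If `q i ∣ r` and every prime power dividing `r` divides at least two of the `q i`, then for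
nonnegative `q i`-periodic functions the sum of the product over a period `r` is at most the
product of the `ℓ²` norms over the individual periods. -/
theorem sum_prod_le_prod_sqrt {ι : Type*} [Fintype ι] [DecidableEq ι] (r : ℕ) (hr : 0 < r)
    (q : ι → ℕ) (hq : ∀ i, q i ∣ r)
    (hpp : ∀ d, IsPrimePow d → d ∣ r → ∃ a b, a ≠ b ∧ d ∣ q a ∧ d ∣ q b)
    (f : ι → ℤ → ℝ) (hf0 : ∀ i x, 0 ≤ f i x) (hf : ∀ i, Periodic (f i) (q i : ℤ)) :
    ∑ x ∈ range r, ∏ i, f i x ≤ ∏ i, √(∑ x ∈ range (q i), f i x ^ 2) := by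
  induction r using Nat.recOnPosPrimePosCoprime generalizing q f with
  | zero => omega
  | one =>
    have hq1 : ∀ i, q i = 1 := fun i => Nat.dvd_one.1 (hq i)
    simp [hq1, Real.sqrt_sq (hf0 _ _)]
  | prime_pow p n hp hn =>
    obtain ⟨a, b, hab, ha, hb⟩ := hpp (p ^ n) (hp.isPrimePow.pow hn.ne') dvd_rfl
    have hqa : q a = p ^ n := Nat.dvd_antisymm (hq a) ha
    have hqb : q b = p ^ n := Nat.dvd_antisymm (hq b) hb
    have hqpos : ∀ i, 0 < q i := fun i => Nat.pos_of_dvd_of_pos (hq i) hr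
    set S : ι → ℝ := fun i => √(∑ x ∈ range (q i), f i x ^ 2) with hS
    have hb' : b ∈ univ.erase a := by simp [hab.symm]
    have hsplit : ∀ F : ι → ℝ, ∏ i, F i = F a * F b * ∏ i ∈ (univ.erase a).erase b, F i := by
      intro F
      rw [← Finset.mul_prod_erase univ F (mem_univ a), ← Finset.mul_prod_erase _ F hb', mul_assoc]
    rw [hsplit]
    set T := ∏ i ∈ (univ.erase a).erase b, S i with hT
    have hT0 : 0 ≤ T := Finset.prod_nonneg fun i _ => Real.sqrt_nonneg _
    calc ∑ x ∈ range (p ^ n), ∏ i, f i x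
        ≤ ∑ x ∈ range (p ^ n), (f a x * f b x) * T := by
          refine Finset.sum_le_sum fun x _ => ?_
          rw [hsplit]
          refine mul_le_mul_of_nonneg_left ?_ (mul_nonneg (hf0 _ _) (hf0 _ _))
          exact Finset.prod_le_prod (fun i _ => hf0 _ _)
            fun i _ => le_sqrt_sum_sq (hqpos i) (hf i) x
      _ = (∑ x ∈ range (p ^ n), f a x * f b x) * T := by rw [Finset.sum_mul]
      _ ≤ S a * S b * T := by
          refine mul_le_mul_of_nonneg_right ?_ hT0
          have := Real.sum_mul_le_sqrt_mul_sqrt (range (p ^ n)) (fun x : ℕ => f a x)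
            (fun x : ℕ => f b x)
          simpa [hS, hqa, hqb] using this
  | coprime A B hA hB hAB ihA ihB =>
    have hA0 : 0 < A := by omega
    have hB0 : 0 < B := by omega
    set qA : ι → ℕ := fun i => (q i).gcd A with hqA
    set qB : ι → ℕ := fun i => (q i).gcd B with hqB
    have hqAB : ∀ i, qA i * qB i = q i := fun i => by
      rw [hqA, hqB]; dsimp only
      rw [← hAB.gcd_mul]
      exact Nat.gcd_eq_left (hq i)
    have hdA : ∀ i, qA i ∣ A := fun i => Nat.gcd_dvd_right _ _
    have hdB : ∀ i, qB i ∣ B := fun i => Nat.gcd_dvd_right _ _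
    have hf' : ∀ i, Periodic (f i) ((qA i * qB i : ℕ) : ℤ) := fun i => by
      rw [hqAB]; exact hf i
    -- summing out the residue modulo `A` replaces `f i` by its `ℓ²` norm along `A`-fibres
    set F : ι → ℤ → ℝ := fun i v => √(∑ u ∈ range (qA i), f i ((B : ℤ) * u + (A : ℤ) * v) ^ 2)
      with hF
    have hprod : Periodic (fun x => ∏ i, f i x) ((A * B : ℕ) : ℤ) := by
      intro x
      exact Finset.prod_congr rfl fun i _ => periodic_of_dvd (hf i) (hq i) x
    have hperA : ∀ (v : ℤ) (i : ι),
        Periodic (fun u : ℤ => f i ((B : ℤ) * u + (A : ℤ) * v)) (qA i : ℤ) := by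
      intro v i u
      refine eq_of_dvd_sub (hf' i) ?_
      obtain ⟨c, hc⟩ := hdB i
      refine ⟨c, ?_⟩
      rw [hc]; push_cast; ring
    have hperB : ∀ (u : ℤ) (i : ι) (v : ℤ),
        f i ((B : ℤ) * u + (A : ℤ) * (v + qB i)) = f i ((B : ℤ) * u + (A : ℤ) * v) := by
      intro u i v
      refine eq_of_dvd_sub (hf' i) ?_
      obtain ⟨c, hc⟩ := hdA i
      refine ⟨c, ?_⟩
      rw [hc]; push_cast; ring
    have hFper : ∀ i, Periodic (F i) (qB i : ℤ) := by
      intro i v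
      simp only [hF, hperB]
    calc ∑ x ∈ range (A * B), ∏ i, f i x
        = ∑ v ∈ range B, ∑ u ∈ range A, ∏ i, f i ((B : ℤ) * u + (A : ℤ) * v) :=
          (sum_range_crt_of_dvd hAB hA0 hB0 dvd_rfl dvd_rfl hprod).symm
      _ ≤ ∑ v ∈ range B, ∏ i, F i v := by
          refine Finset.sum_le_sum fun v _ => ?_
          refine ihA hA0 qA hdA ?_ (fun i u => f i ((B : ℤ) * u + (A : ℤ) * v))
            (fun i u => hf0 _ _) (hperA v)
          intro d hd hdvd
          obtain ⟨a, b, hab, ha, hb⟩ := hpp d hd (hdvd.mul_right B)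
          exact ⟨a, b, hab, Nat.dvd_gcd ha hdvd, Nat.dvd_gcd hb hdvd⟩
      _ ≤ ∏ i, √(∑ v ∈ range (qB i), F i v ^ 2) := by
          refine ihB hB0 qB hdB ?_ F (fun i v => Real.sqrt_nonneg _) hFper
          intro d hd hdvd
          obtain ⟨a, b, hab, ha, hb⟩ := hpp d hd (hdvd.mul_left A)
          exact ⟨a, b, hab, Nat.dvd_gcd ha hdvd, Nat.dvd_gcd hb hdvd⟩
      _ = ∏ i, √(∑ x ∈ range (q i), f i x ^ 2) := by
          refine Finset.prod_congr rfl fun i _ => ?_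
          congr 1
          rw [← hqAB i, ← sum_range_crt_of_dvd (f := fun x => f i x ^ 2) hAB hA0 hB0 (hdA i)
            (hdB i) ((hf' i).comp (· ^ 2))]
          refine Finset.sum_congr rfl fun v _ => ?_
          exact Real.sq_sqrt (Finset.sum_nonneg fun _ _ => sq_nonneg _)

/-! ### Primitive functions and their sums over short intervals -/

/-- The indicator function of the multiples of `d`. -/
def dvdInd (d : ℕ) (x : ℤ) : ℝ := if (d : ℤ) ∣ x then 1 else 0

theorem dvdInd_nonneg (d : ℕ) (x : ℤ) : 0 ≤ dvdInd d x := by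
  unfold dvdInd; split_ifs <;> norm_num

theorem dvdInd_periodic (d : ℕ) : Periodic (dvdInd d) (d : ℤ) := by
  intro x; simp [dvdInd]

theorem sum_range_dvdInd {d : ℕ} (hd : 0 < d) : ∑ x ∈ range d, dvdInd d x = 1 := by
  rw [Finset.sum_eq_single_of_mem 0 (mem_range.2 hd)]
  · simp [dvdInd]
  · intro b hb hb0
    have : ¬ d ∣ b := fun h => hb0 (Nat.eq_zero_of_dvd_of_lt h (mem_range.1 hb))
    simp [dvdInd, Int.natCast_dvd_natCast, this]

theorem gcd_le_sum_divisors {q : ℕ} (hq : 0 < q) (y : ℤ) :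
    (Int.gcd y q : ℝ) ≤ ∑ d ∈ q.divisors, (d : ℝ) * dvdInd d y := by
  have h1 : Int.gcd y q ∈ q.divisors := by
    rw [Nat.mem_divisors]
    exact ⟨by exact_mod_cast Int.gcd_dvd_right y (q : ℤ), hq.ne'⟩
  refine le_trans ?_ (Finset.single_le_sum (f := fun d : ℕ => (d : ℝ) * dvdInd d y)
    (fun d _ => mul_nonneg (Nat.cast_nonneg _) (dvdInd_nonneg _ _)) h1)
  have : dvdInd (Int.gcd y q) y = 1 := if_pos (Int.gcd_dvd_left y (q : ℤ))
  simp [this]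

theorem mul_sum_dvdInd_le {d : ℕ} (hd : 0 < d) (l : ℕ) (x : ℤ) :
    (d : ℝ) * ∑ n ∈ range l, dvdInd d (x + n) ≤ l + d := by
  have hper : Periodic (fun n : ℤ => dvdInd d (x + n)) (d : ℤ) := by
    intro n
    have := dvdInd_periodic d (x + n)
    simpa [add_assoc] using this
  have h1 : ∑ n ∈ range l, dvdInd d (x + n) ≤
      ∑ n ∈ range (d * (l / d + 1)), dvdInd d (x + n) := by
    refine Finset.sum_le_sum_of_subset_of_nonneg ?_ fun _ _ _ => dvdInd_nonneg _ _
    exact range_subset_range.2 (Nat.lt_mul_div_succ l hd).le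
  have h2 := sum_range_mul hper (l / d + 1)
  have h3 := sum_range_add (dvdInd_periodic d) x
  simp only [add_comm _ x] at h3
  rw [h3, sum_range_dvdInd hd] at h2
  rw [h2] at h1
  have h4 : (d : ℝ) * (l / d : ℕ) ≤ l := by exact_mod_cast Nat.mul_div_le l d
  have hd' : (0 : ℝ) < d := by exact_mod_cast hd
  push_cast at h1
  nlinarith

theorem mul_sum_range_dvdInd {d q : ℕ} (hd : 0 < d) (hdq : d ∣ q) (a : ℤ) :
    (d : ℝ) * ∑ x ∈ range q, dvdInd d (x + a) = q := by
  obtain ⟨k, rfl⟩ := hdq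
  have := sum_range_add (periodic_of_dvd (dvdInd_periodic d) (Dvd.intro k rfl)) a
  rw [this, sum_range_mul (dvdInd_periodic d), sum_range_dvdInd hd]
  push_cast; ring

/-- Cauchy's inequality over the divisors of `q`; each `d` contributes its multiples in an interval
of length `l ≤ q`, of which there are at most `l / d + 1`. -/
theorem sum_sq_sum_gcd_le {q l : ℕ} (hl : l ≤ q) :
    ∑ x ∈ range q, (∑ n ∈ range l, (Int.gcd (x + n : ℤ) q : ℝ)) ^ 2 ≤
      2 * (q.divisors.card : ℝ) ^ 2 * (q : ℝ) ^ 2 * l := by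
  rcases Nat.eq_zero_or_pos q with rfl | hq
  · simp
  have hτ : (0 : ℝ) ≤ q.divisors.card := Nat.cast_nonneg _
  set M : ℕ → ℤ → ℝ := fun d x => (d : ℝ) * ∑ n ∈ range l, dvdInd d (x + n) with hM
  have hM0 : ∀ d x, 0 ≤ M d x := fun d x =>
    mul_nonneg (Nat.cast_nonneg _) (Finset.sum_nonneg fun _ _ => dvdInd_nonneg _ _)
  have h1 : ∀ x : ℤ, ∑ n ∈ range l, (Int.gcd (x + n : ℤ) q : ℝ) ≤ ∑ d ∈ q.divisors, M d x := by
    intro x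
    simp only [hM, Finset.mul_sum]
    rw [Finset.sum_comm]
    exact Finset.sum_le_sum fun n _ => gcd_le_sum_divisors hq _
  have h2 : ∀ d ∈ q.divisors, ∑ x ∈ range q, M d x ^ 2 ≤ 2 * (q : ℝ) ^ 2 * l := by
    intro d hd
    have hdq := Nat.dvd_of_mem_divisors hd
    have hd0 := Nat.pos_of_dvd_of_pos hdq hq
    have hdle : (d : ℝ) ≤ q := by exact_mod_cast Nat.le_of_dvd hq hdq
    have hlle : (l : ℝ) ≤ q := by exact_mod_cast hl
    calc ∑ x ∈ range q, M d x ^ 2 ≤ ∑ x ∈ range q, 2 * (q : ℝ) * M d x := by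
          refine Finset.sum_le_sum fun x _ => ?_
          rw [sq]
          refine mul_le_mul_of_nonneg_right ?_ (hM0 _ _)
          have := mul_sum_dvdInd_le hd0 l (x : ℤ)
          simp only [hM]; linarith
      _ = 2 * (q : ℝ) * ∑ n ∈ range l, ((d : ℝ) * ∑ x ∈ range q, dvdInd d (x + n)) := by
          rw [← Finset.mul_sum, ← Finset.mul_sum, ← Finset.mul_sum, Finset.sum_comm]
      _ = 2 * (q : ℝ) ^ 2 * l := by
          simp only [mul_sum_range_dvdInd hd0 hdq]
          rw [Finset.sum_const, card_range, nsmul_eq_mul]; ring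
  calc ∑ x ∈ range q, (∑ n ∈ range l, (Int.gcd (x + n : ℤ) q : ℝ)) ^ 2
      ≤ ∑ x ∈ range q, (q.divisors.card : ℝ) * ∑ d ∈ q.divisors, M d x ^ 2 := by
        refine Finset.sum_le_sum fun x _ => ?_
        refine le_trans (pow_le_pow_left₀ (Finset.sum_nonneg fun _ _ => Nat.cast_nonneg _)
          (h1 x) 2) sq_sum_le_card_mul_sum_sq
    _ = (q.divisors.card : ℝ) * ∑ d ∈ q.divisors, ∑ x ∈ range q, M d x ^ 2 := by
        rw [← Finset.mul_sum, Finset.sum_comm]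
    _ ≤ (q.divisors.card : ℝ) * ∑ d ∈ q.divisors, 2 * (q : ℝ) ^ 2 * l :=
        mul_le_mul_of_nonneg_left (Finset.sum_le_sum h2) hτ
    _ = 2 * (q.divisors.card : ℝ) ^ 2 * (q : ℝ) ^ 2 * l := by
        rw [Finset.sum_const, nsmul_eq_mul]; ring

/-- A `q`-periodic function is *primitive of level `q`* if it sums to zero over every coset of
every subgroup of order `p` of `ℤ/q`, for all primes `p ∣ q`. -/
structure IsPrimitive (q : ℕ) (G : ℤ → ℝ) : Prop where
  periodic : Periodic G (q : ℤ)
  sum_eq_zero : ∀ p, p.Prime → p ∣ q → ∀ c : ℤ, ¬ (p : ℤ) ∣ c → ∀ x,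
    ∑ b ∈ range p, G (x + b * (((q / p : ℕ) : ℤ) * c)) = 0

/-- The sum of `G` over the interval `x + 1, …, x + h`. -/
def shiftSum (h : ℕ) (G : ℤ → ℝ) (x : ℤ) : ℝ := ∑ n ∈ range h, G (x + (n + 1))

theorem IsPrimitive.shiftSum {q : ℕ} {G : ℤ → ℝ} (hG : IsPrimitive q G) (h : ℕ) :
    IsPrimitive q (shiftSum h G) where
  periodic := by
    intro x
    exact Finset.sum_congr rfl fun n _ =>
      (congrArg G (by ring)).trans (hG.periodic (x + (n + 1)))
  sum_eq_zero := by
    intro p hp hpq c hc x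
    simp only [SumTwoSquares.shiftSum]
    rw [Finset.sum_comm]
    refine Finset.sum_eq_zero fun n _ => ?_
    rw [← hG.sum_eq_zero p hp hpq c hc (x + (n + 1))]
    refine Finset.sum_congr rfl fun b _ => ?_
    congr 1; ring

theorem IsPrimitive.sum_range_eq_zero {q : ℕ} {G : ℤ → ℝ} (hG : IsPrimitive q G) (hq : 1 < q) :
    ∑ x ∈ range q, G x = 0 := by
  obtain ⟨p, hp, hpq⟩ := Nat.exists_prime_and_dvd hq.ne'
  have h1 : ∑ b ∈ range p, ∑ x ∈ range q, G (x + b * (((q / p : ℕ) : ℤ) * 1)) = 0 := by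
    rw [Finset.sum_comm]
    refine Finset.sum_eq_zero fun x _ => hG.sum_eq_zero p hp hpq 1 ?_ x
    intro h
    exact hp.one_lt.ne' (by exact_mod_cast Int.eq_one_of_dvd_one (by positivity) h)
  simp only [sum_range_add hG.periodic, Finset.sum_const, card_range, nsmul_eq_mul] at h1
  rcases mul_eq_zero.1 h1 with h | h
  · exact absurd (by exact_mod_cast h) hp.pos.ne'
  · exact h

/-- Up to divisor functions the square sum over a period is at most `h`, even for `q < h`: complete
periods cancel, so only `h % q` terms of the interval matter. -/
theorem IsPrimitive.sum_sq_shiftSum_le {q : ℕ} {G : ℤ → ℝ} (hG : IsPrimitive q G) (hq : 1 < q)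
    {V : ℝ} (hV : ∀ x, |G x| ≤ V * (Int.gcd x q / q)) (h : ℕ) :
    ∑ x ∈ range q, SumTwoSquares.shiftSum h G x ^ 2 ≤
      2 * h * (V * q.divisors.card) ^ 2 := by
  have hq0 : (0 : ℝ) < q := by exact_mod_cast (by omega : 0 < q)
  have key : ∀ x, SumTwoSquares.shiftSum h G x = ∑ n ∈ range (h % q), G (x + 1 + n) := by
    intro x
    have hper : Periodic (fun n : ℤ => G (x + 1 + n)) (q : ℤ) := by
      intro n
      have := hG.periodic (x + 1 + n)
      simpa [add_assoc] using this
    have h1 : SumTwoSquares.shiftSum h G x =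
        ∑ n ∈ range (q * (h / q) + h % q), G (x + 1 + n) := by
      rw [Nat.div_add_mod]
      refine Finset.sum_congr rfl fun n _ => ?_
      congr 1; ring
    have h2 := sum_range_add hG.periodic (x + 1)
    simp only [add_comm _ (x + 1)] at h2
    rw [h1, Finset.sum_range_add, sum_range_mul hper, h2, hG.sum_range_eq_zero hq, mul_zero,
      zero_add]
    refine Finset.sum_congr rfl fun n _ => eq_of_dvd_sub hG.periodic ⟨(h / q : ℕ), ?_⟩
    push_cast; ring
  have hper : Periodic (fun x => SumTwoSquares.shiftSum h G x ^ 2) (q : ℤ) :=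
    (hG.shiftSum h).periodic.comp (· ^ 2)
  rw [← sum_range_add hper (-1)]
  have hl : h % q ≤ q := (Nat.mod_lt _ (by omega)).le
  have hlh : ((h % q : ℕ) : ℝ) ≤ h := by exact_mod_cast Nat.mod_le h q
  have hb : ∀ x : ℤ, SumTwoSquares.shiftSum h G (x + -1) ^ 2 ≤
      (V / q) ^ 2 * (∑ n ∈ range (h % q), (Int.gcd (x + n) q : ℝ)) ^ 2 := by
    intro x
    rw [key, ← mul_pow, ← sq_abs]
    refine pow_le_pow_left₀ (abs_nonneg _) ?_ 2
    refine (Finset.abs_sum_le_sum_abs _ _).trans ?_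
    rw [Finset.mul_sum]
    refine Finset.sum_le_sum fun n _ => ?_
    refine (hV _).trans_eq ?_
    rw [show x + -1 + 1 + (n : ℤ) = x + n by ring]; ring
  calc _ ≤ ∑ x ∈ range q, (V / q) ^ 2 * (∑ n ∈ range (h % q), (Int.gcd (x + n : ℤ) q : ℝ)) ^ 2 :=
        Finset.sum_le_sum fun x _ => hb x
    _ ≤ (V / q) ^ 2 * (2 * (q.divisors.card : ℝ) ^ 2 * (q : ℝ) ^ 2 * (h % q : ℕ)) := by
        rw [← Finset.mul_sum]
        exact mul_le_mul_of_nonneg_left (sum_sq_sum_gcd_le hl) (sq_nonneg _)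
    _ = 2 * (h % q : ℕ) * (V * q.divisors.card) ^ 2 := by field_simp
    _ ≤ _ := by gcongr

/-! ### Vanishing and the moment bound for primitive expansions -/

theorem dvd_div_of_not_pow_dvd {p n q r : ℕ} (hp : p.Prime) (hqr : q ∣ r) (hr : p ^ n ∣ r)
    (hq : ¬ p ^ n ∣ q) : q ∣ r / p := by
  obtain ⟨c, rfl⟩ := hqr
  by_cases hpc : p ∣ c
  · obtain ⟨e, rfl⟩ := hpc
    refine ⟨e, ?_⟩
    rw [show q * (p * e) = p * (q * e) by ring, Nat.mul_div_cancel_left _ hp.pos]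
  · exact absurd (((hp.coprime_iff_not_dvd.2 hpc).pow_left n).dvd_of_dvd_mul_right hr) hq

/-- If some prime power divides the least common multiple `r` of the levels but only one of them,
then averaging over the cosets of the subgroup of order `p` of `ℤ/r` kills the product. -/
theorem sum_prod_eq_zero {ι : Type*} [Fintype ι] [DecidableEq ι] {q : ι → ℕ}
    (hq : ∀ i, 0 < q i) {A : ι → ℤ → ℝ} (hA : ∀ i, IsPrimitive (q i) (A i)) {d : ℕ}
    (hd : IsPrimePow d) (hdr : d ∣ univ.lcm q)
    (hpp : ∀ a b, a ≠ b → d ∣ q a → ¬ d ∣ q b) :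
    ∑ x ∈ range (univ.lcm q), ∏ i, A i x = 0 := by
  obtain ⟨p, n, hp', hn, rfl⟩ := hd
  have hp : p.Prime := hp'.nat_prime
  have hqr : ∀ i, q i ∣ univ.lcm q := fun i => Finset.dvd_lcm (mem_univ i)
  set r := univ.lcm q with hr
  have hr0 : 0 < r := by
    refine Nat.pos_of_ne_zero fun h => ?_
    rw [hr, Finset.lcm_eq_zero_iff] at h
    obtain ⟨i, _, hi⟩ := h
    exact (hq i).ne' hi
  have hpr : p ∣ r := (dvd_pow_self p hn.ne').trans hdr
  have hrp : ¬ r ∣ r / p := fun h => by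
    have h1 := Nat.le_of_dvd (Nat.div_pos (Nat.le_of_dvd hr0 hpr) hp.pos) h
    have h2 := Nat.div_lt_self hr0 hp.one_lt
    omega
  obtain ⟨a, ha⟩ : ∃ a, p ^ n ∣ q a := by
    by_contra! hcon
    exact hrp (Finset.lcm_dvd fun i _ => dvd_div_of_not_pow_dvd hp (hqr i) hdr (hcon i))
  have hothers : ∀ i, i ≠ a → q i ∣ r / p := fun i hi =>
    dvd_div_of_not_pow_dvd hp (hqr i) hdr (hpp a i hi.symm ha)
  obtain ⟨c, hc⟩ := hqr a
  have hpc : ¬ p ∣ c := by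
    intro hpc
    have : q a ∣ r / p := by
      obtain ⟨e, rfl⟩ := hpc
      refine ⟨e, ?_⟩
      rw [hc, show q a * (p * e) = p * (q a * e) by ring, Nat.mul_div_cancel_left _ hp.pos]
    refine hrp (Finset.lcm_dvd fun i _ => ?_)
    by_cases hi : i = a
    · rw [hi]; exact this
    · exact hothers i hi
  have hpa : p ∣ q a := (dvd_pow_self p hn.ne').trans ha
  have hrpc : r / p = q a / p * c := by
    rw [hc]; exact Nat.mul_div_right_comm hpa c
  have hper : Periodic (fun x => ∏ i, A i x) (r : ℤ) := by
    intro x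
    exact Finset.prod_congr rfl fun i _ => periodic_of_dvd (hA i).periodic (hqr i) x
  have h1 : ∑ b ∈ range p, ∑ x ∈ range r, ∏ i, A i (x + b * ((r / p : ℕ) : ℤ)) = 0 := by
    rw [Finset.sum_comm]
    refine Finset.sum_eq_zero fun x _ => ?_
    have h2 : ∀ b ∈ range p, ∏ i, A i (x + b * ((r / p : ℕ) : ℤ)) =
        A a (x + b * (((q a / p : ℕ) : ℤ) * c)) * ∏ i ∈ univ.erase a, A i x := by
      intro b _
      rw [← Finset.mul_prod_erase univ _ (mem_univ a)]
      congr 1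
      · rw [hrpc]; push_cast; rfl
      · refine Finset.prod_congr rfl fun i hi => ?_
        refine eq_of_dvd_sub (hA i).periodic ?_
        rw [add_sub_cancel_left]
        exact (Int.natCast_dvd_natCast.2 (hothers i (Finset.ne_of_mem_erase hi))).mul_left _
    rw [Finset.sum_congr rfl h2, ← Finset.sum_mul,
      (hA a).sum_eq_zero p hp hpa c (by exact_mod_cast hpc), zero_mul]
  have h3 : ∀ b : ℕ, ∑ x ∈ range r, ∏ i, A i (x + b * ((r / p : ℕ) : ℤ)) =
      ∑ x ∈ range r, ∏ i, A i x := fun b => sum_range_add hper _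
  simp only [h3, Finset.sum_const, card_range, nsmul_eq_mul] at h1
  rcases mul_eq_zero.1 h1 with h | h
  · exact absurd (by exact_mod_cast h) hp.pos.ne'
  · exact h

/-- Either the sum vanishes, or the levels satisfy the hypothesis of `sum_prod_le_prod_sqrt`. -/
theorem abs_sum_prod_shiftSum_le {m : ℕ} {q : Fin m → ℕ} (hq : ∀ i, 1 < q i) {G : Fin m → ℤ → ℝ}
    (hG : ∀ i, IsPrimitive (q i) (G i)) {V : Fin m → ℝ} (hV0 : ∀ i, 0 ≤ V i)
    (hV : ∀ i x, |G i x| ≤ V i * (Int.gcd x (q i) / q i)) (h : ℕ) :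
    |∑ x ∈ range (univ.lcm q), ∏ i, shiftSum h (G i) x| ≤
      √(2 * h) ^ m * ∏ i, (V i * (q i).divisors.card) := by
  have hq0 : ∀ i, 0 < q i := fun i => by have := hq i; omega
  have hr0 : 0 < univ.lcm q := by
    refine Nat.pos_of_ne_zero fun h => ?_
    rw [Finset.lcm_eq_zero_iff] at h
    obtain ⟨i, _, hi⟩ := h
    exact (hq0 i).ne' hi
  have hB : 0 ≤ √(2 * h) ^ m * ∏ i, (V i * (q i).divisors.card) :=
    mul_nonneg (by positivity)
      (Finset.prod_nonneg fun i _ => mul_nonneg (hV0 i) (Nat.cast_nonneg _))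
  by_cases hpp : ∀ d, IsPrimePow d → d ∣ univ.lcm q → ∃ a b, a ≠ b ∧ d ∣ q a ∧ d ∣ q b
  · have hper : ∀ i, Periodic (fun x => |shiftSum h (G i) x|) (q i : ℤ) := fun i =>
      ((hG i).shiftSum h).periodic.comp abs
    calc _ ≤ ∑ x ∈ range (univ.lcm q), ∏ i, |shiftSum h (G i) x| := by
          refine (Finset.abs_sum_le_sum_abs _ _).trans_eq ?_
          simp only [Finset.abs_prod]
      _ ≤ ∏ i, √(∑ x ∈ range (q i), |shiftSum h (G i) x| ^ 2) :=
          sum_prod_le_prod_sqrt _ hr0 q (fun i => Finset.dvd_lcm (mem_univ i)) hpp _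
            (fun i x => abs_nonneg _) hper
      _ ≤ ∏ i, (√(2 * h) * (V i * (q i).divisors.card)) := by
          refine Finset.prod_le_prod (fun i _ => Real.sqrt_nonneg _) fun i _ => ?_
          rw [← Real.sqrt_sq (mul_nonneg (hV0 i) (Nat.cast_nonneg (q i).divisors.card)),
            ← Real.sqrt_mul (by positivity)]
          refine Real.sqrt_le_sqrt ?_
          simp only [sq_abs]
          exact (hG i).sum_sq_shiftSum_le (hq i) (hV i) h
      _ = _ := by rw [Finset.prod_mul_distrib, Finset.prod_const, card_univ, Fintype.card_fin]
  · push Not at hpp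
    obtain ⟨d, hd, hdr, hab⟩ := hpp
    rw [sum_prod_eq_zero hq0 (fun i => (hG i).shiftSum h) hd hdr hab, abs_zero]
    exact hB

/-- Moment bound for sums over short intervals of a function expanded into primitive parts. -/
theorem abs_moment_le {N : ℕ} (hN : 0 < N) {g : ℕ → ℤ → ℝ} {V : ℕ → ℝ}
    (hg : ∀ q, q ∣ N → IsPrimitive q (g q)) (hV0 : ∀ q, 0 ≤ V q)
    (hV : ∀ q, q ∣ N → ∀ x, |g q x| ≤ V q * (Int.gcd x q / q))
    (hmono : ∀ q r, q ∣ r → r ∣ N → V q ≤ V r) (m h : ℕ) :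
    |∑ x ∈ range N, (shiftSum h (fun y => ∑ q ∈ N.divisors.erase 1, g q y) x) ^ m| ≤
      N * (√(2 * h) ^ m * ∑ r ∈ N.divisors, (V r * (r.divisors.card : ℝ) ^ 2) ^ m / r) := by
  set D := N.divisors.erase 1 with hD
  have hDdvd : ∀ q ∈ D, q ∣ N := fun q hq => Nat.dvd_of_mem_divisors (Finset.mem_of_mem_erase hq)
  have hD1 : ∀ q ∈ D, 1 < q := fun q hq => by
    have h1 := Nat.pos_of_dvd_of_pos (hDdvd q hq) hN
    have h2 := Finset.ne_of_mem_erase hq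
    omega
  set S : Finset (Fin m → ℕ) := Fintype.piFinset fun _ => D with hS
  have hSD : ∀ t ∈ S, ∀ i, t i ∈ D := fun t ht i => Fintype.mem_piFinset.1 ht i
  have hexp : ∀ x : ℤ, (shiftSum h (fun y => ∑ q ∈ D, g q y) x) ^ m =
      ∑ t ∈ S, ∏ i, shiftSum h (g (t i)) x := by
    intro x
    have h1 : shiftSum h (fun y => ∑ q ∈ D, g q y) x = ∑ q ∈ D, shiftSum h (g q) x := by
      simp only [shiftSum]; rw [Finset.sum_comm]
    rw [h1, hS, ← Finset.prod_univ_sum (fun _ : Fin m => D) (fun _ q => shiftSum h (g q) x),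
      Finset.prod_const, card_univ, Fintype.card_fin]
  have hlcm : ∀ t ∈ S, univ.lcm t ∣ N := fun t ht =>
    Finset.lcm_dvd fun i _ => hDdvd _ (hSD t ht i)
  set W : (Fin m → ℕ) → ℝ := fun t => ∏ i, (V (t i) * (t i).divisors.card) with hW
  have hW0 : ∀ t, 0 ≤ W t := fun t =>
    Finset.prod_nonneg fun i _ => mul_nonneg (hV0 _) (Nat.cast_nonneg _)
  have hterm : ∀ t ∈ S, |∑ x ∈ range N, ∏ i, shiftSum h (g (t i)) x| ≤
      N * √(2 * h) ^ m * (W t / (univ.lcm t : ℕ)) := by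
    intro t ht
    have h0 : (0 : ℝ) < (univ.lcm t : ℕ) := by
      exact_mod_cast Nat.pos_of_dvd_of_pos (hlcm t ht) hN
    have hper : Periodic (fun x => ∏ i, shiftSum h (g (t i)) x) ((univ.lcm t : ℕ) : ℤ) := by
      intro x
      exact Finset.prod_congr rfl fun i _ => periodic_of_dvd
        ((hg _ (hDdvd _ (hSD t ht i))).shiftSum h).periodic (Finset.dvd_lcm (mem_univ i)) x
    have h1 := abs_sum_prod_shiftSum_le (fun i => hD1 _ (hSD t ht i))
      (fun i => hg _ (hDdvd _ (hSD t ht i))) (fun i => hV0 (t i))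
      (fun i => hV _ (hDdvd _ (hSD t ht i))) h
    have h2 := sum_range_mul hper (N / univ.lcm t)
    rw [Nat.mul_div_cancel' (hlcm t ht)] at h2
    rw [h2, abs_mul, Nat.abs_cast, Nat.cast_div (hlcm t ht) h0.ne']
    refine (mul_le_mul_of_nonneg_left h1 (by positivity)).trans_eq ?_
    simp only [hW]; ring
  have hτ : ∀ q r : ℕ, q ∣ r → 0 < r → (q.divisors.card : ℝ) ≤ r.divisors.card :=
    fun q r hqr hr => by exact_mod_cast card_le_card (Nat.divisors_subset_of_dvd hr.ne' hqr)
  have hfib : ∀ r ∈ N.divisors, ∑ t ∈ S with univ.lcm t = r, W t / (univ.lcm t : ℕ) ≤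
      (V r * (r.divisors.card : ℝ) ^ 2) ^ m / r := by
    intro r hr
    have hrN := Nat.dvd_of_mem_divisors hr
    have hr0 := Nat.pos_of_dvd_of_pos hrN hN
    calc ∑ t ∈ S with univ.lcm t = r, W t / (univ.lcm t : ℕ)
        = ∑ t ∈ S with univ.lcm t = r, W t / r := by
          refine Finset.sum_congr rfl fun t ht => ?_
          rw [(Finset.mem_filter.1 ht).2]
      _ ≤ ∑ t ∈ Fintype.piFinset fun _ : Fin m => r.divisors, W t / r := by
          refine Finset.sum_le_sum_of_subset_of_nonneg ?_
            fun t _ _ => div_nonneg (hW0 t) (Nat.cast_nonneg _)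
          intro t ht
          rw [Fintype.mem_piFinset]
          intro i
          rw [Nat.mem_divisors]
          refine ⟨?_, hr0.ne'⟩
          rw [← (Finset.mem_filter.1 ht).2]
          exact Finset.dvd_lcm (mem_univ i)
      _ = (∑ q ∈ r.divisors, V q * q.divisors.card) ^ m / r := by
          rw [← Finset.sum_div, hW, ← Finset.prod_univ_sum (fun _ : Fin m => r.divisors)
            (fun _ q => V q * (q.divisors.card : ℝ)),
            Finset.prod_const, card_univ, Fintype.card_fin]
      _ ≤ _ := by
          refine div_le_div_of_nonneg_right (pow_le_pow_left₀ (Finset.sum_nonneg fun q _ =>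
            mul_nonneg (hV0 q) (Nat.cast_nonneg _)) ?_ m) (Nat.cast_nonneg _)
          calc ∑ q ∈ r.divisors, V q * q.divisors.card
              ≤ ∑ q ∈ r.divisors, V r * r.divisors.card := by
                refine Finset.sum_le_sum fun q hq => ?_
                have hqr := Nat.dvd_of_mem_divisors hq
                exact mul_le_mul (hmono q r hqr hrN) (hτ q r hqr hr0) (Nat.cast_nonneg _) (hV0 r)
            _ = _ := by rw [Finset.sum_const, nsmul_eq_mul]; ring
  calc |∑ x ∈ range N, (shiftSum h (fun y => ∑ q ∈ D, g q y) x) ^ m|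
      = |∑ t ∈ S, ∑ x ∈ range N, ∏ i, shiftSum h (g (t i)) x| := by
        simp only [hexp]; rw [Finset.sum_comm]
    _ ≤ ∑ t ∈ S, N * √(2 * h) ^ m * (W t / (univ.lcm t : ℕ)) :=
        (Finset.abs_sum_le_sum_abs _ _).trans (Finset.sum_le_sum hterm)
    _ = N * √(2 * h) ^ m * ∑ r ∈ N.divisors, ∑ t ∈ S with univ.lcm t = r,
          W t / (univ.lcm t : ℕ) := by
        rw [← Finset.mul_sum, Finset.sum_fiberwise_of_maps_to]
        exact fun t ht => Nat.mem_divisors.2 ⟨hlcm t ht, hN.ne'⟩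
    _ ≤ _ := by
        rw [mul_assoc]
        gcongr with r hr
        exact hfib r hr

/-! ### Decomposition of a product of local functions into primitive parts -/

theorem sum_divisors_coprime_mul {m n : ℕ} (hmn : m.Coprime n) (F : ℕ → ℝ) :
    ∑ q ∈ (m * n).divisors, F q = ∑ a ∈ m.divisors, ∑ b ∈ n.divisors, F (a * b) := by
  rw [Nat.divisors_mul, Finset.mul_def, Finset.sum_image hmn.mul_injOn_divisors,
    Finset.sum_product]

theorem coprime_pow_prod {P : Finset ℕ} (hP : ∀ p ∈ P, p.Prime) {p : ℕ} (hp : p.Prime)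
    (hpP : p ∉ P) (e : ℕ → ℕ) (k : ℕ) : (p ^ k).Coprime (∏ l ∈ P, l ^ e l) := by
  refine Nat.Coprime.prod_right fun l hl => Nat.Coprime.pow _ _ ?_
  exact (Nat.coprime_primes hp (hP l hl)).2 fun h => hpP (h ▸ hl)

/-- The divisors of `∏ p ^ α` correspond to the tuples of exponents at most `α`. -/
theorem sum_divisors_prod_pow {P : Finset ℕ} (hP : ∀ p ∈ P, p.Prime) (α : ℕ)
    (w : ℕ → ℕ → ℝ) :
    ∑ q ∈ (∏ p ∈ P, p ^ α).divisors, ∏ p ∈ P, w p (q.factorization p) =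
      ∏ p ∈ P, ∑ j ∈ range (α + 1), w p j := by
  induction P using Finset.induction_on with
  | empty => simp
  | insert p P hpP ih =>
    have hp : p.Prime := hP p (mem_insert_self _ _)
    have hP' : ∀ l ∈ P, l.Prime := fun l hl => hP l (mem_insert_of_mem hl)
    have hcop := coprime_pow_prod hP' hp hpP (fun _ => α) α
    rw [Finset.prod_insert hpP, sum_divisors_coprime_mul hcop, Nat.divisors_prime_pow hp,
      Finset.sum_map, Finset.prod_insert hpP, ← ih hP', Finset.sum_mul]
    refine Finset.sum_congr rfl fun j _ => ?_
    rw [Finset.mul_sum]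
    refine Finset.sum_congr rfl fun b hb => ?_
    have hbdvd := Nat.dvd_of_mem_divisors hb
    have hb0 : b ≠ 0 := (Nat.pos_of_mem_divisors hb).ne'
    have hpb : b.factorization p = 0 := by
      apply Nat.factorization_eq_zero_of_not_dvd
      intro h
      have h1 := coprime_pow_prod hP' hp hpP (fun _ => α) 1
      rw [pow_one] at h1
      exact (hp.coprime_iff_not_dvd.1 h1) (h.trans hbdvd)
    have hpj : p ^ j ≠ 0 := pow_ne_zero _ hp.ne_zero
    simp only [Embedding.coeFn_mk]
    rw [Finset.prod_insert hpP, Nat.factorization_mul hpj hb0, Nat.Prime.factorization_pow hp]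
    congr 1
    · simp [hpb]
    · refine Finset.prod_congr rfl fun l hl => ?_
      have : l ≠ p := fun h => hpP (h ▸ hl)
      simp [this.symm]

theorem factorization_prod_pow {P : Finset ℕ} (hP : ∀ p ∈ P, p.Prime) (α : ℕ) {p : ℕ}
    (hp : p ∈ P) : (∏ l ∈ P, l ^ α).factorization p = α := by
  rw [Nat.factorization_prod fun l hl => pow_ne_zero _ (hP l hl).ne_zero]
  rw [Finset.sum_apply', Finset.sum_eq_single_of_mem p hp]
  · simp [(hP p hp).factorization_self]
  · intro l hl hlp
    simp [(hP l hl).factorization, hlp]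

theorem prod_pow_pos {P : Finset ℕ} (hP : ∀ p ∈ P, p.Prime) (α : ℕ) : 0 < ∏ l ∈ P, l ^ α :=
  Finset.prod_pos fun l hl => pow_pos (hP l hl).pos _

theorem primeFactors_subset_of_dvd_prod_pow {P : Finset ℕ} (hP : ∀ p ∈ P, p.Prime) {α q : ℕ}
    (hq : q ∣ ∏ l ∈ P, l ^ α) : q.primeFactors ⊆ P := by
  intro p hp
  have hpp := Nat.prime_of_mem_primeFactors hp
  have h1 := (Nat.dvd_of_mem_primeFactors hp).trans hq
  obtain ⟨l, hl, hpl⟩ := (hpp.prime.dvd_finsetProd_iff _).1 h1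
  rwa [(Nat.prime_dvd_prime_iff_eq hpp (hP l hl)).1 (hpp.dvd_of_dvd_pow hpl)]

theorem factorization_le_of_dvd_prod_pow {P : Finset ℕ} (hP : ∀ p ∈ P, p.Prime) {α q p : ℕ}
    (hq : q ∣ ∏ l ∈ P, l ^ α) (hp : p ∈ P) : q.factorization p ≤ α := by
  have h0 := prod_pow_pos hP α
  have := (Nat.factorization_le_iff_dvd (Nat.pos_of_dvd_of_pos hq h0).ne' h0.ne').2 hq p
  rwa [factorization_prod_pow hP α hp] at this

theorem prod_pow_factorization_of_subset {P : Finset ℕ} {q : ℕ} (hq : q ≠ 0)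
    (hqP : q.primeFactors ⊆ P) : ∏ p ∈ P, p ^ q.factorization p = q := by
  rw [← Finset.prod_subset hqP]
  · exact Nat.prod_factorization_pow_eq_self hq
  · intro p _ hp
    rw [← Nat.support_factorization, Finsupp.notMem_support_iff] at hp
    rw [hp, pow_zero]

theorem card_divisors_of_subset {P : Finset ℕ} {q : ℕ} (hq : q ≠ 0)
    (hqP : q.primeFactors ⊆ P) : q.divisors.card = ∏ p ∈ P, (q.factorization p + 1) := by
  rw [Nat.card_divisors hq]
  refine Finset.prod_subset hqP ?_
  intro p _ hp
  rw [← Nat.support_factorization, Finsupp.notMem_support_iff] at hp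
  rw [hp, zero_add]

/-- The average of `f` over the coset of `p ^ j ℤ` through `x`, for a `p ^ α`-periodic `f`. -/
noncomputable def cosetMean (p α : ℕ) (f : ℤ → ℝ) (j : ℕ) (x : ℤ) : ℝ :=
  (∑ b ∈ range (p ^ (α - j)), f (x + (p : ℤ) ^ j * b)) / (p : ℝ) ^ (α - j)

/-- The component of `f` of exact level `p ^ j`: the part of `f` that depends on `x` modulo
`p ^ j` and averages to zero over the residues lying above a given residue modulo `p ^ (j - 1)`. -/
noncomputable def levelPart (p α : ℕ) (f : ℤ → ℝ) : ℕ → ℤ → ℝ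
  | 0, x => cosetMean p α f 0 x
  | j + 1, x => cosetMean p α f (j + 1) x - cosetMean p α f j x

section CosetMean

variable {p α : ℕ} {f : ℤ → ℝ}

theorem comp_mul_periodic (hf : Periodic f ((p ^ α : ℕ) : ℤ)) {j k : ℕ} (hjk : j + k = α) (x : ℤ) :
    Periodic (fun b : ℤ => f (x + (p : ℤ) ^ j * b)) ((p ^ k : ℕ) : ℤ) := by
  intro b
  refine eq_of_dvd_sub hf ⟨1, ?_⟩
  subst hjk
  push_cast; ring

theorem cosetMean_periodic (hf : Periodic f ((p ^ α : ℕ) : ℤ)) {j : ℕ} (hj : j ≤ α) :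
    Periodic (cosetMean p α f j) ((p ^ j : ℕ) : ℤ) := by
  intro x
  unfold cosetMean
  congr 1
  rw [← sum_range_add (comp_mul_periodic hf (by omega : j + (α - j) = α) x) 1]
  refine Finset.sum_congr rfl fun b _ => ?_
  congr 1; push_cast; ring

theorem cosetMean_self (x : ℤ) : cosetMean p α f α x = f x := by
  simp [cosetMean]

/-- The tower property of conditional means. The multiplier `c` prime to `p` allows the cosets to be
reached by the translations that come from the subgroup of order `p` of `ℤ/q`, `p ^ (j + 1) ∥ q`. -/
theorem sum_cosetMean_succ (hp : p.Prime) (hf : Periodic f ((p ^ α : ℕ) : ℤ)) {j : ℕ}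
    (hj : j < α) {c : ℤ} (hc : ¬ (p : ℤ) ∣ c) (x : ℤ) :
    ∑ b ∈ range p, cosetMean p α f (j + 1) (x + b * ((p : ℤ) ^ j * c)) =
      p * cosetMean p α f j x := by
  obtain ⟨k, rfl⟩ : ∃ k, α = j + 1 + k := ⟨α - (j + 1), by omega⟩
  have hp0 : (p : ℝ) ≠ 0 := by exact_mod_cast hp.ne_zero
  have e1 : j + 1 + k - (j + 1) = k := by omega
  have e2 : j + 1 + k - j = k + 1 := by omega
  unfold cosetMean
  rw [e1, e2, ← Finset.sum_div]
  have key : ∑ b ∈ range p, ∑ i ∈ range (p ^ k),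
      f (x + b * ((p : ℤ) ^ j * c) + (p : ℤ) ^ (j + 1) * i) =
      ∑ b ∈ range (p ^ (k + 1)), f (x + (p : ℤ) ^ j * b) := by
    rw [← Finset.sum_product', ← sum_eq_of_injOn (pow_pos hp.pos (k + 1))
      (comp_mul_periodic hf (by ring : j + (k + 1) = j + 1 + k) x) (range p ×ˢ range (p ^ k))
      (fun z => (z.1 : ℤ) * c + p * z.2) (by simp [pow_succ, mul_comm])]
    · refine Finset.sum_congr rfl fun z _ => ?_
      congr 1; ring
    · rintro ⟨b, i⟩ h1 ⟨b', i'⟩ h2 ⟨e, he⟩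
      simp only [mem_product, mem_range] at h1 h2
      dsimp only at he
      have hb : b = b' := by
        refine eq_of_dvd_sub_of_lt h1.1 h2.1 ?_
        have hpc : IsCoprime (p : ℤ) c := (Nat.prime_iff_prime_int.1 hp).coprime_iff_not_dvd.2 hc
        refine hpc.dvd_of_dvd_mul_right ⟨(p : ℤ) ^ k * e - (i - i'), ?_⟩
        push_cast at he
        rw [pow_succ] at he
        linear_combination he
      subst hb
      rw [Prod.mk.injEq]
      refine ⟨rfl, eq_of_dvd_sub_of_lt h1.2 h2.2 ⟨e, ?_⟩⟩
      have hpz : (p : ℤ) ≠ 0 := by exact_mod_cast hp.ne_zero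
      apply mul_left_cancel₀ hpz
      push_cast at he ⊢
      rw [pow_succ] at he
      linear_combination he
  rw [key]
  field_simp
  ring

theorem levelPart_periodic (hf : Periodic f ((p ^ α : ℕ) : ℤ)) {j : ℕ} (hj : j ≤ α) :
    Periodic (levelPart p α f j) ((p ^ j : ℕ) : ℤ) := by
  cases j with
  | zero => exact cosetMean_periodic hf hj
  | succ j =>
    intro x
    have h1 := cosetMean_periodic hf hj x
    have h2 := periodic_of_dvd (cosetMean_periodic hf (by omega : j ≤ α)) (pow_dvd_pow p j.le_succ)
      x
    simp only [levelPart]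
    rw [h1, h2]

theorem sum_levelPart_eq_zero (hp : p.Prime) (hf : Periodic f ((p ^ α : ℕ) : ℤ)) {j : ℕ}
    (hj : j < α) {c : ℤ} (hc : ¬ (p : ℤ) ∣ c) (x : ℤ) :
    ∑ b ∈ range p, levelPart p α f (j + 1) (x + b * ((p : ℤ) ^ j * c)) = 0 := by
  simp only [levelPart]
  rw [Finset.sum_sub_distrib, sum_cosetMean_succ hp hf hj hc]
  have : ∀ b ∈ range p, cosetMean p α f j (x + b * ((p : ℤ) ^ j * c)) = cosetMean p α f j x := by
    intro b _
    refine eq_of_dvd_sub (cosetMean_periodic hf hj.le) ⟨b * c, ?_⟩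
    push_cast; ring
  rw [Finset.sum_congr rfl this]
  simp

theorem sum_levelPart (x : ℤ) : ∑ j ∈ range (α + 1), levelPart p α f j x = f x := by
  rw [Finset.sum_range_succ']
  simp only [levelPart]
  rw [Finset.sum_range_sub (fun j => cosetMean p α f j x), cosetMean_self]
  ring

end CosetMean

/-- The component of exact level `q` of the product of local functions `f p`, `p ∈ P`. -/
noncomputable def prodLevelPart (P : Finset ℕ) (α : ℕ) (f : ℕ → ℤ → ℝ) (q : ℕ) (x : ℤ) : ℝ :=
  ∏ p ∈ P, levelPart p α (f p) (q.factorization p) x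

theorem sum_prodLevelPart {P : Finset ℕ} (hP : ∀ p ∈ P, p.Prime) (α : ℕ) (f : ℕ → ℤ → ℝ) (x : ℤ) :
    ∑ q ∈ (∏ p ∈ P, p ^ α).divisors, prodLevelPart P α f q x = ∏ p ∈ P, f p x := by
  unfold prodLevelPart
  rw [sum_divisors_prod_pow hP α fun p j => levelPart p α (f p) j x]
  exact Finset.prod_congr rfl fun p _ => sum_levelPart x

theorem prodLevelPart_isPrimitive {P : Finset ℕ} (hP : ∀ p ∈ P, p.Prime) {α : ℕ}
    {f : ℕ → ℤ → ℝ} (hf : ∀ p ∈ P, Periodic (f p) ((p ^ α : ℕ) : ℤ)) {q : ℕ} (hq : q ∣ ∏ p ∈ P, p ^ α) :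
    IsPrimitive q (prodLevelPart P α f q) where
  periodic := by
    intro x
    refine Finset.prod_congr rfl fun p hp => ?_
    exact periodic_of_dvd (levelPart_periodic (hf p hp) (factorization_le_of_dvd_prod_pow hP hq hp))
      (Nat.ordProj_dvd q p) x
  sum_eq_zero := by
    intro p hp hpq c hc x
    have hq0 : q ≠ 0 := (Nat.pos_of_dvd_of_pos hq (prod_pow_pos hP α)).ne'
    have hpP : p ∈ P :=
      primeFactors_subset_of_dvd_prod_pow hP hq (Nat.mem_primeFactors.2 ⟨hp, hpq, hq0⟩)
    have hle := factorization_le_of_dvd_prod_pow hP hq hpP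
    obtain ⟨j, hj⟩ : ∃ j, q.factorization p = j + 1 :=
      ⟨q.factorization p - 1, by have := hp.factorization_pos_of_dvd hq0 hpq; omega⟩
    have hqe := Nat.ordProj_mul_ordCompl_eq_self q p
    have hcop := Nat.not_dvd_ordCompl hp hq0
    set e := q / p ^ q.factorization p with he
    rw [hj] at hqe
    have hqp : q / p = p ^ j * e := by
      rw [← hqe, show p ^ (j + 1) * e = p * (p ^ j * e) by ring, Nat.mul_div_cancel_left _ hp.pos]
    have hterm : ∀ b ∈ range p, prodLevelPart P α f q (x + b * (((q / p : ℕ) : ℤ) * c)) =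
        levelPart p α (f p) (j + 1) (x + b * ((p : ℤ) ^ j * (e * c))) *
          ∏ l ∈ P.erase p, levelPart l α (f l) (q.factorization l) x := by
      intro b _
      unfold prodLevelPart
      rw [← Finset.mul_prod_erase P _ hpP, hj]
      congr 1
      · rw [hqp]; push_cast; congr 1; ring
      · refine Finset.prod_congr rfl fun l hl => ?_
        have hlP := Finset.mem_of_mem_erase hl
        refine eq_of_dvd_sub (levelPart_periodic (hf l hlP)
          (factorization_le_of_dvd_prod_pow hP hq hlP)) ?_
        rw [add_sub_cancel_left]
        have h1 : l ^ q.factorization l ∣ q / p := by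
          have h2 : l ^ q.factorization l ∣ p * (q / p) := by
            rw [Nat.mul_div_cancel' hpq]; exact Nat.ordProj_dvd q l
          refine Nat.Coprime.dvd_of_dvd_mul_left (Nat.Coprime.pow_left _ ?_) h2
          exact (Nat.coprime_primes (hP l hlP) hp).2 (Finset.ne_of_mem_erase hl)
        exact ((Int.natCast_dvd_natCast.2 h1).mul_right c).mul_left _
    rw [Finset.sum_congr rfl hterm, ← Finset.sum_mul,
      sum_levelPart_eq_zero hp (hf p hpP) (by omega), zero_mul]
    intro h
    rcases Int.Prime.dvd_mul' hp h with h | h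
    · exact hcop (by exact_mod_cast h)
    · exact hc h

/-! ### Sums of two squares modulo prime powers -/

/-- `x` is congruent to a sum of two squares modulo `M`. -/
def IsSumTwoSqMod (M : ℕ) (x : ℤ) : Prop := ∃ u v : ℤ, x ≡ u ^ 2 + v ^ 2 [ZMOD (M : ℤ)]

theorem IsSumTwoSqMod.mul {M : ℕ} {x y : ℤ} (hx : IsSumTwoSqMod M x) (hy : IsSumTwoSqMod M y) :
    IsSumTwoSqMod M (x * y) := by
  obtain ⟨a, b, hx⟩ := hx
  obtain ⟨c, d, hy⟩ := hy
  refine ⟨a * c - b * d, a * d + b * c, (hx.mul hy).trans ?_⟩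
  rw [show (a * c - b * d) ^ 2 + (a * d + b * c) ^ 2 = (a ^ 2 + b ^ 2) * (c ^ 2 + d ^ 2) by ring]

theorem IsSumTwoSqMod.of_dvd_sub {M : ℕ} {x y : ℤ} (hx : IsSumTwoSqMod M x)
    (h : (M : ℤ) ∣ x - y) : IsSumTwoSqMod M y := by
  obtain ⟨a, b, hx⟩ := hx
  exact ⟨a, b, ((Int.modEq_iff_dvd.2 h).trans hx)⟩

/-- Hensel lifting of square roots for odd `p`. -/
theorem exists_sq_sub_dvd_of_odd {p : ℕ} (hp : p.Prime) (h2 : p ≠ 2) {w t : ℤ}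
    (hw : ¬ (p : ℤ) ∣ w) (ht : (p : ℤ) ∣ t ^ 2 - w) (α : ℕ) :
    ∃ s : ℤ, (p : ℤ) ^ (α + 1) ∣ s ^ 2 - w := by
  have hpp := Nat.prime_iff_prime_int.1 hp
  induction α with
  | zero => exact ⟨t, by simpa using ht⟩
  | succ α ih =>
    obtain ⟨s, k, hk⟩ := ih
    have hs : ¬ (p : ℤ) ∣ s := by
      intro h
      apply hw
      have h1 : (p : ℤ) ∣ s ^ 2 - w := (dvd_pow_self _ α.succ_ne_zero).trans ⟨k, hk⟩
      have h3 := dvd_sub (h.trans (dvd_pow_self s two_ne_zero)) h1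
      rwa [sub_sub_cancel] at h3
    have h2s : ¬ (p : ℤ) ∣ 2 * s := by
      intro h
      rcases hpp.dvd_or_dvd h with h | h
      · exact h2 ((Nat.prime_dvd_prime_iff_eq hp Nat.prime_two).1 (by exact_mod_cast h))
      · exact hs h
    obtain ⟨a, b, hab⟩ := hpp.coprime_iff_not_dvd.2 h2s
    refine ⟨s + (p : ℤ) ^ (α + 1) * (-b * k), k * a + (p : ℤ) ^ α * (b * k) ^ 2, ?_⟩
    have hk' : k = k * (a * p + b * (2 * s)) := by rw [hab, mul_one]
    have e1 : (p : ℤ) ^ (α + 1 + 1) = p * (p : ℤ) ^ (α + 1) := by ring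
    have e2 : (p : ℤ) ^ (α + 1) = p * (p : ℤ) ^ α := by ring
    rw [e1]
    linear_combination hk + (p : ℤ) ^ (α + 1) * hk' + (p : ℤ) ^ (α + 1) * (b * k) ^ 2 * e2

theorem isSumTwoSqMod_of_odd_prime {p : ℕ} (hp : p.Prime) (h2 : p ≠ 2) {x : ℤ}
    (hx : ¬ (p : ℤ) ∣ x) (α : ℕ) : IsSumTwoSqMod (p ^ α) x := by
  have hpp := Nat.prime_iff_prime_int.1 hp
  have := Fact.mk hp
  obtain ⟨a, b, -, -, hab⟩ := Nat.sq_add_sq_zmodEq p x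
  have main : ∀ a b : ℤ, a ^ 2 + b ^ 2 ≡ x [ZMOD p] → ¬ (p : ℤ) ∣ a →
      IsSumTwoSqMod (p ^ α) x := by
    intro a b hab ha
    have h1 : (p : ℤ) ∣ a ^ 2 - (x - b ^ 2) := by
      have := Int.modEq_iff_dvd.1 hab.symm
      convert this using 1; ring
    have h3 : ¬ (p : ℤ) ∣ x - b ^ 2 := fun h => ha (hpp.dvd_of_dvd_pow (n := 2) (by
      have := dvd_add h1 h; simpa using this))
    obtain ⟨s, hs⟩ := exists_sq_sub_dvd_of_odd hp h2 h3 h1 α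
    refine ⟨s, b, Int.modEq_iff_dvd.2 ?_⟩
    obtain ⟨k, hk⟩ := (pow_dvd_pow (p : ℤ) α.le_succ).trans hs
    exact ⟨k, by push_cast; linear_combination hk⟩
  by_cases ha : (p : ℤ) ∣ a
  · refine main b a (by rw [add_comm]; exact hab) fun hb => hx ?_
    have h1 := (Int.modEq_iff_dvd.1 hab)
    have h3 := dvd_add h1 (dvd_add (ha.trans (dvd_pow_self (a : ℤ) two_ne_zero))
      (hb.trans (dvd_pow_self (b : ℤ) two_ne_zero)))
    simpa using h3
  · exact main a b hab ha

/-- Hensel lifting of square roots for `p = 2`. -/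
theorem exists_sq_sub_dvd_two_pow {w : ℤ} (hw : 8 ∣ w - 1) (α : ℕ) :
    ∃ s : ℤ, (2 : ℤ) ^ (α + 3) ∣ s ^ 2 - w := by
  induction α with
  | zero => exact ⟨1, by obtain ⟨k, hk⟩ := hw; exact ⟨-k, by linear_combination -hk⟩⟩
  | succ α ih =>
    obtain ⟨s, k, hk⟩ := ih
    have hs : Odd s := by
      by_contra h
      rw [Int.not_odd_iff_even] at h
      obtain ⟨t, rfl⟩ := h
      obtain ⟨e, he⟩ := hw
      have : (2 : ℤ) ^ (α + 3) * k = 2 * ((2 : ℤ) ^ (α + 2) * k) := by ring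
      have h3 : (t + t) ^ 2 = 2 * (2 * t ^ 2) := by ring
      omega
    rcases Int.even_or_odd k with ⟨l, rfl⟩ | ⟨l, rfl⟩
    · exact ⟨s, l, by rw [hk]; ring⟩
    · obtain ⟨t, rfl⟩ := hs
      refine ⟨2 * t + 1 + 2 ^ (α + 2), l + t + 1 + 2 ^ α, ?_⟩
      linear_combination hk

/-- A number that is `1` modulo `4` is, modulo `8`, of the form `1 + 0²` or `1 + 2²`. -/
theorem isSumTwoSqMod_two_pow {w : ℤ} (hw : 4 ∣ w - 1) (α : ℕ) : IsSumTwoSqMod (2 ^ α) w := by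
  have key : ∀ w c : ℤ, 8 ∣ w - c ^ 2 - 1 → IsSumTwoSqMod (2 ^ α) w := by
    intro w c h
    obtain ⟨s, hs⟩ := exists_sq_sub_dvd_two_pow h α
    refine ⟨s, c, Int.modEq_iff_dvd.2 ?_⟩
    obtain ⟨k, hk⟩ := (pow_dvd_pow (2 : ℤ) (by omega : α ≤ α + 3)).trans hs
    exact ⟨k, by push_cast; linear_combination hk⟩
  by_cases h8 : 8 ∣ w - 1
  · exact key w 0 (by simpa using h8)
  · exact key w 2 (by omega)

/-- For odd `p`, whether `p ^ v * u` with `p ∤ u` is a sum of two squares modulo a power of `p`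
does not depend on `u`. -/
theorem IsSumTwoSqMod.transfer_odd {p : ℕ} (hp : p.Prime) (h2 : p ≠ 2) {α v : ℕ} {u u' : ℤ}
    (hu : ¬ (p : ℤ) ∣ u) (hu' : ¬ (p : ℤ) ∣ u') (h : IsSumTwoSqMod (p ^ α) ((p : ℤ) ^ v * u)) :
    IsSumTwoSqMod (p ^ α) ((p : ℤ) ^ v * u') := by
  have hpp := Nat.prime_iff_prime_int.1 hp
  have hcop : IsCoprime ((p : ℤ) ^ (α + 1)) u := (hpp.coprime_iff_not_dvd.2 hu).pow_left
  obtain ⟨a, s, has⟩ := hcop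
  have hs : ¬ (p : ℤ) ∣ s := fun hs => hpp.not_dvd_one (by
    rw [← has]
    exact dvd_add ((dvd_pow_self _ α.succ_ne_zero).mul_left a) (hs.mul_right u))
  have hw : IsSumTwoSqMod (p ^ α) (u' * s) :=
    isSumTwoSqMod_of_odd_prime hp h2 (fun h => (hpp.dvd_or_dvd h).elim hu' hs) α
  refine (h.mul hw).of_dvd_sub ⟨-(p : ℤ) ^ v * u' * a * p, ?_⟩
  push_cast
  linear_combination (p : ℤ) ^ v * u' * has

/-- For `p = 2`, whether `2 ^ v * u` with `u` odd is a sum of two squares modulo a power of `2` depends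
only on `u` modulo `4`. -/
theorem IsSumTwoSqMod.transfer_two {α v : ℕ} {u u' : ℤ}
    (hu : ¬ (2 : ℤ) ∣ u) (huu' : 4 ∣ u' - u) (h : IsSumTwoSqMod (2 ^ α) ((2 : ℤ) ^ v * u)) :
    IsSumTwoSqMod (2 ^ α) ((2 : ℤ) ^ v * u') := by
  have hcop : IsCoprime ((2 : ℤ) ^ (α + 2)) u :=
    (Int.prime_two.coprime_iff_not_dvd.2 hu).pow_left
  obtain ⟨a, s, has⟩ := hcop
  have hw : IsSumTwoSqMod (2 ^ α) (u' * s) := by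
    refine isSumTwoSqMod_two_pow ?_ α
    obtain ⟨k, hk⟩ := huu'
    refine ⟨k * s - a * 2 ^ α, ?_⟩
    linear_combination has + s * hk
  refine (h.mul hw).of_dvd_sub ⟨-(2 : ℤ) ^ v * u' * a * 4, ?_⟩
  push_cast
  linear_combination (2 : ℤ) ^ v * u' * has

open Classical in
/-- The indicator function of the sums of two squares modulo `p ^ α`. -/
noncomputable def ssInd (p α : ℕ) (x : ℤ) : ℝ := if IsSumTwoSqMod (p ^ α) x then 1 else 0

theorem ssInd_nonneg (p α : ℕ) (x : ℤ) : 0 ≤ ssInd p α x := by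
  unfold ssInd; split_ifs <;> norm_num

theorem ssInd_le_one (p α : ℕ) (x : ℤ) : ssInd p α x ≤ 1 := by
  unfold ssInd; split_ifs <;> norm_num

theorem ssInd_of_isSumTwoSqMod {p α : ℕ} {x : ℤ} (h : IsSumTwoSqMod (p ^ α) x) :
    ssInd p α x = 1 := if_pos h

theorem ssInd_congr {p α : ℕ} {x y : ℤ}
    (h : IsSumTwoSqMod (p ^ α) x ↔ IsSumTwoSqMod (p ^ α) y) : ssInd p α x = ssInd p α y := by
  by_cases hx : IsSumTwoSqMod (p ^ α) x
  · rw [ssInd_of_isSumTwoSqMod hx, ssInd_of_isSumTwoSqMod (h.1 hx)]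
  · rw [ssInd, ssInd, if_neg hx, if_neg fun hy => hx (h.2 hy)]

theorem ssInd_periodic (p α : ℕ) : Periodic (ssInd p α) ((p ^ α : ℕ) : ℤ) := by
  intro x
  have : IsSumTwoSqMod (p ^ α) (x + (p ^ α : ℕ)) ↔ IsSumTwoSqMod (p ^ α) x :=
    ⟨fun h => h.of_dvd_sub (by simp), fun h => h.of_dvd_sub (by simp)⟩
  exact ssInd_congr this

theorem ssInd_transfer_odd {p : ℕ} (hp : p.Prime) (h2 : p ≠ 2) (α v : ℕ) {u u' : ℤ}
    (hu : ¬ (p : ℤ) ∣ u) (hu' : ¬ (p : ℤ) ∣ u') :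
    ssInd p α ((p : ℤ) ^ v * u) = ssInd p α ((p : ℤ) ^ v * u') := by
  have : IsSumTwoSqMod (p ^ α) ((p : ℤ) ^ v * u) ↔ IsSumTwoSqMod (p ^ α) ((p : ℤ) ^ v * u') :=
    ⟨fun h => h.transfer_odd hp h2 hu hu', fun h => h.transfer_odd hp h2 hu' hu⟩
  exact ssInd_congr this

theorem ssInd_transfer_two (α v : ℕ) {u u' : ℤ} (hu : ¬ (2 : ℤ) ∣ u) (huu' : 4 ∣ u' - u) :
    ssInd 2 α ((2 : ℤ) ^ v * u) = ssInd 2 α ((2 : ℤ) ^ v * u') := by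
  have : IsSumTwoSqMod (2 ^ α) ((2 : ℤ) ^ v * u) ↔ IsSumTwoSqMod (2 ^ α) ((2 : ℤ) ^ v * u') :=
    ⟨fun h => h.transfer_two hu huu', fun h => h.transfer_two (by omega) (by omega)⟩
  exact ssInd_congr this

theorem densityMod_eq (H : Finset ℤ) (p α : ℕ) :
    densityMod H p α = (∑ x ∈ range (p ^ α), ∏ t ∈ H, ssInd p α (x + t)) / (p : ℝ) ^ α := by
  classical
  have h1 : goodResidues H p α =
      ((range (p ^ α)).filter fun x : ℕ => ∀ t ∈ H, IsSumTwoSqMod (p ^ α) (x + t) : Finset ℕ) := by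
    ext x
    simp [goodResidues, IsSumTwoSqMod]
  rw [densityMod, h1, Set.ncard_coe_finset, Finset.card_filter]
  congr 1
  push_cast
  refine Finset.sum_congr rfl fun x _ => ?_
  simp only [ssInd]
  rw [Finset.prod_ite_zero]
  simp

theorem sum_ssInd {p : ℕ} (hp : p.Prime) (α : ℕ) :
    ∑ x ∈ range (p ^ α), ssInd p α x = densityMod {0} p α * (p : ℝ) ^ α := by
  have : (p : ℝ) ^ α ≠ 0 := pow_ne_zero _ (by exact_mod_cast hp.ne_zero)
  rw [densityMod_eq]
  simp [this]

theorem densityMod_nonneg (H : Finset ℤ) (p α : ℕ) : 0 ≤ densityMod H p α := by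
  unfold densityMod; positivity

theorem densityMod_le_one (H : Finset ℤ) (p α : ℕ) : densityMod H p α ≤ 1 := by
  rw [densityMod_eq]
  refine div_le_one_of_le₀ ?_ (by positivity)
  calc _ ≤ ∑ x ∈ range (p ^ α), (1 : ℝ) := Finset.sum_le_sum fun x _ =>
        Finset.prod_le_one (fun _ _ => ssInd_nonneg _ _ _) fun _ _ => ssInd_le_one _ _ _
    _ = _ := by simp

/-- Sums of two squares modulo `p ^ (α + 1)` are sums of two squares modulo `p ^ α`. -/
theorem densityMod_antitone (H : Finset ℤ) {p : ℕ} (hp : p.Prime) :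
    Antitone (densityMod H p) := by
  refine antitone_nat_of_succ_le fun α => ?_
  have hp0 : (0 : ℝ) < p := by exact_mod_cast hp.pos
  have hmono : ∀ x, ssInd p (α + 1) x ≤ ssInd p α x := by
    intro x
    by_cases h : IsSumTwoSqMod (p ^ (α + 1)) x
    · rw [ssInd_of_isSumTwoSqMod h, ssInd_of_isSumTwoSqMod]
      obtain ⟨u, v, h⟩ := h
      exact ⟨u, v, h.of_dvd (by exact_mod_cast pow_dvd_pow p α.le_succ)⟩
    · rw [ssInd, if_neg h]; exact ssInd_nonneg _ _ _
  have hper : Periodic (fun x : ℤ => ∏ t ∈ H, ssInd p α (x + t)) ((p ^ α : ℕ) : ℤ) := by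
    intro x
    refine Finset.prod_congr rfl fun t _ => ?_
    rw [← ssInd_periodic p α (x + t)]; congr 1; ring
  have h2 := sum_range_mul hper p
  rw [← pow_succ] at h2
  rw [densityMod_eq, densityMod_eq, div_le_div_iff₀ (by positivity) (by positivity)]
  have h3 : ∑ x ∈ range (p ^ (α + 1)), ∏ t ∈ H, ssInd p (α + 1) (x + t) ≤
      ∑ x ∈ range (p ^ (α + 1)), ∏ t ∈ H, ssInd p α (x + t) :=
    Finset.sum_le_sum fun x _ => Finset.prod_le_prod (fun _ _ => ssInd_nonneg _ _ _)
      fun _ _ => hmono _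
  rw [h2] at h3
  calc _ ≤ (p * ∑ x ∈ range (p ^ α), ∏ t ∈ H, ssInd p α (x + t)) * (p : ℝ) ^ α :=
        mul_le_mul_of_nonneg_right h3 (by positivity)
    _ = _ := by ring

theorem tendsto_densityMod (H : Finset ℤ) {p : ℕ} (hp : p.Prime) :
    Filter.Tendsto (fun α : ℕ => densityMod H p α) Filter.atTop (nhds (localDensity H p)) := by
  have h := tendsto_atTop_ciInf (densityMod_antitone H hp)
    ⟨0, by rintro _ ⟨α, rfl⟩; exact densityMod_nonneg _ _ _⟩
  exact tendsto_nhds_limUnder ⟨_, h⟩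

/-- For odd `p`, the residues that are not sums of two squares are multiples of `p`. -/
theorem one_sub_inv_le_densityMod {p : ℕ} (hp : p.Prime) (h2 : p ≠ 2) {α : ℕ} (hα : 1 ≤ α) :
    1 - 1 / (p : ℝ) ≤ densityMod {0} p α := by
  have hp0 : (0 : ℝ) < p := by exact_mod_cast hp.pos
  have h1 : ∀ x : ℤ, 1 - dvdInd p x ≤ ssInd p α x := by
    intro x
    by_cases hx : (p : ℤ) ∣ x
    · rw [dvdInd, if_pos hx, sub_self]; exact ssInd_nonneg _ _ _
    · rw [ssInd_of_isSumTwoSqMod (isSumTwoSqMod_of_odd_prime hp h2 hx α)]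
      linarith [dvdInd_nonneg p x]
  have h3 := Finset.sum_le_sum fun (x : ℕ) (_ : x ∈ range (p ^ α)) => h1 x
  rw [sum_ssInd hp, Finset.sum_sub_distrib] at h3
  have h4 := mul_sum_range_dvdInd hp.pos (dvd_pow_self p (by omega : α ≠ 0)) 0
  simp only [add_zero, sum_const, card_range, nsmul_eq_mul, mul_one] at h3 h4
  push_cast at h3 h4
  have h5 : (0 : ℝ) < (p : ℝ) ^ α := by positivity
  refine le_of_mul_le_mul_right ?_ h5
  refine le_trans (le_of_eq ?_) h3
  rw [← h4]; field_simp

theorem quarter_le_densityMod {p : ℕ} (hp : p.Prime) {α : ℕ} (hα : 2 ≤ α) :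
    1 / 4 ≤ densityMod {0} p α := by
  by_cases h2 : p = 2
  · subst h2
    have h1 : ∀ x : ℤ, dvdInd 4 (x + (-1)) ≤ ssInd 2 α x := by
      intro x
      by_cases hx : ((4 : ℕ) : ℤ) ∣ x + (-1)
      · rw [ssInd_of_isSumTwoSqMod (isSumTwoSqMod_two_pow (by simpa [sub_eq_add_neg] using hx) α), dvdInd, if_pos hx]
      · rw [dvdInd, if_neg hx]; exact ssInd_nonneg _ _ _
    have h3 := Finset.sum_le_sum fun (x : ℕ) (_ : x ∈ range (2 ^ α)) => h1 x
    have h4 := mul_sum_range_dvdInd (by norm_num : 0 < 4) (pow_dvd_pow 2 hα) (-1)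
    rw [sum_ssInd hp] at h3
    push_cast at h3 h4
    have h5 : (0 : ℝ) < (2 : ℝ) ^ α := by positivity
    refine le_of_mul_le_mul_right ?_ h5
    linarith
  · have h3 : (2 : ℝ) ≤ p := by exact_mod_cast hp.two_le
    have h4 := one_sub_inv_le_densityMod hp h2 (by omega : 1 ≤ α)
    have h5 : 1 / (p : ℝ) ≤ 1 / 2 := by gcongr
    linarith

/-- If the elements of `H` are distinct modulo the odd prime `p`, the residues spoiling different
shifts are disjoint. -/
theorem densityMod_eq_of_distinct {p : ℕ} (hp : p.Prime) (h2 : p ≠ 2) {H : Finset ℤ}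
    (hH : ∀ s ∈ H, ∀ t ∈ H, (p : ℤ) ∣ s - t → s = t) (α : ℕ) :
    densityMod H p α = 1 - H.card * (1 - densityMod {0} p α) := by
  have hp0 : (p : ℝ) ^ α ≠ 0 := pow_ne_zero _ (by exact_mod_cast hp.ne_zero)
  have key : ∀ x : ℤ, ∏ t ∈ H, ssInd p α (x + t) = 1 - ∑ t ∈ H, (1 - ssInd p α (x + t)) := by
    intro x
    have hbad : ∀ t, ssInd p α (x + t) ≠ 1 → (p : ℤ) ∣ x + t := by
      intro t ht
      by_contra h
      exact ht (ssInd_of_isSumTwoSqMod (isSumTwoSqMod_of_odd_prime hp h2 h α))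
    by_cases hall : ∀ t ∈ H, ssInd p α (x + t) = 1
    · rw [Finset.prod_eq_one hall, Finset.sum_eq_zero fun t ht => by rw [hall t ht, sub_self],
        sub_zero]
    · push Not at hall
      obtain ⟨s, hs, hs1⟩ := hall
      have hs0 : ssInd p α (x + s) = 0 := by
        unfold ssInd at hs1 ⊢
        split_ifs with h
        · exact absurd (if_pos h) hs1
        · rfl
      rw [Finset.prod_eq_zero hs hs0, Finset.sum_eq_single_of_mem s hs, hs0]
      · norm_num
      · intro t ht hts
        by_contra hne
        refine hts (hH t ht s hs ?_)
        have := dvd_sub (hbad t fun h => hne (by rw [h, sub_self])) (hbad s hs1)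
        simpa using this
  have hshift : ∀ t : ℤ, ∑ x ∈ range (p ^ α), ssInd p α (x + t) =
      densityMod {0} p α * (p : ℝ) ^ α := fun t => by
    rw [sum_range_add (ssInd_periodic p α), sum_ssInd hp]
  rw [densityMod_eq]
  simp only [key]
  rw [Finset.sum_sub_distrib, Finset.sum_comm]
  simp only [Finset.sum_sub_distrib, hshift]
  simp only [sum_const, card_range, nsmul_eq_mul]
  push_cast
  field_simp

/-! ### Local bounds for the indicator function of the sums of two squares -/

section LevelPartBound

variable {p α : ℕ} {f : ℤ → ℝ} {K : ℝ}

theorem cosetMean_nonneg (hf : ∀ x, 0 ≤ f x) (j : ℕ) (x : ℤ) : 0 ≤ cosetMean p α f j x :=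
  div_nonneg (Finset.sum_nonneg fun _ _ => hf _) (by positivity)

theorem cosetMean_le (hp : p.Prime) (hf : ∀ x, f x ≤ K) (j : ℕ) (x : ℤ) :
    cosetMean p α f j x ≤ K := by
  have : (0 : ℝ) < (p : ℝ) ^ (α - j) := pow_pos (by exact_mod_cast hp.pos) _
  rw [cosetMean, div_le_iff₀ this]
  refine (Finset.sum_le_sum fun _ _ => hf _).trans_eq ?_
  simp [mul_comm]

theorem cosetMean_eq_of_const (hp : p.Prime) {j : ℕ} {x : ℤ} {c : ℝ}
    (h : ∀ b : ℤ, f (x + (p : ℤ) ^ j * b) = c) : cosetMean p α f j x = c := by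
  have : (p : ℝ) ^ (α - j) ≠ 0 := pow_ne_zero _ (by exact_mod_cast hp.ne_zero)
  simp [cosetMean, h, this]

theorem levelPart_eq_zero_of_const (hp : p.Prime) {j : ℕ} {x : ℤ} {c : ℝ}
    (h : ∀ b : ℤ, f (x + (p : ℤ) ^ j * b) = c) : levelPart p α f (j + 1) x = 0 := by
  rw [levelPart, cosetMean_eq_of_const hp h, cosetMean_eq_of_const (c := c) hp, sub_self]
  intro b
  rw [← h (p * b)]; congr 1; ring

theorem abs_levelPart_succ_le (hp : p.Prime) (hf0 : ∀ x, 0 ≤ f x) (hfK : ∀ x, f x ≤ K) (j : ℕ)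
    (x : ℤ) : |levelPart p α f (j + 1) x| ≤ K := by
  rw [levelPart, abs_sub_le_iff]
  have h1 := cosetMean_nonneg (p := p) (α := α) hf0 (j + 1) x
  have h2 := cosetMean_nonneg (p := p) (α := α) hf0 j x
  have h3 := cosetMean_le (α := α) hp hfK (j + 1) x
  have h4 := cosetMean_le (α := α) hp hfK j x
  constructor <;> linarith

theorem le_gcd_of_dvd {q : ℕ} (hq : 0 < q) {d : ℕ} {x : ℤ} (hdq : d ∣ q) (hdx : (d : ℤ) ∣ x) :
    (d : ℝ) ≤ Int.gcd x q := by
  have h : d ∣ Int.gcd x q := by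
    have := Int.dvd_coe_gcd hdx (Int.natCast_dvd_natCast.2 hdq)
    exact_mod_cast this
  exact_mod_cast Nat.le_of_dvd (Int.gcd_pos_of_ne_zero_right _ (by exact_mod_cast hq.ne')) h

theorem exists_eq_pow_mul_of_not_dvd (hp : p.Prime) {j : ℕ} {x : ℤ} (hx : ¬ (p : ℤ) ^ j ∣ x) :
    ∃ v u, v < j ∧ ¬ (p : ℤ) ∣ u ∧ x = (p : ℤ) ^ v * u := by
  have hx0 : x ≠ 0 := fun h => hx (h ▸ dvd_zero _)
  have hfin : FiniteMultiplicity (p : ℤ) x :=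
    Int.finiteMultiplicity_iff.2 ⟨by simpa using hp.one_lt.ne', hx0⟩
  obtain ⟨u, hu, hpu⟩ := hfin.exists_eq_pow_mul_and_not_dvd
  refine ⟨multiplicity (p : ℤ) x, u, ?_, hpu, hu⟩
  by_contra! hlt
  exact hx ((pow_dvd_pow _ hlt).trans ⟨u, hu⟩)

/-- If `f (p ^ v * u)` with `p ∤ u` does not depend on `u`, the component of level `p ^ (j + 1)`
vanishes off the multiples of `p ^ j` and is of relative size `1 / p` at those which are not
multiples of `p ^ (j + 1)`. -/
theorem abs_levelPart_le_of_odd (hp : p.Prime) (hper : Periodic f ((p ^ α : ℕ) : ℤ))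
    (hf0 : ∀ x, 0 ≤ f x) (hfK : ∀ x, f x ≤ K)
    (hf : ∀ v u u', ¬ (p : ℤ) ∣ u → ¬ (p : ℤ) ∣ u' → f ((p : ℤ) ^ v * u) = f ((p : ℤ) ^ v * u'))
    {j : ℕ} (hj : j < α) (x : ℤ) :
    |levelPart p α f (j + 1) x| ≤ K * (Int.gcd x (p ^ (j + 1) : ℕ) / (p ^ (j + 1) : ℕ)) := by
  have hK : 0 ≤ K := (hf0 0).trans (hfK 0)
  have hp0 : (0 : ℝ) < p := by exact_mod_cast hp.pos
  have hpp := Nat.prime_iff_prime_int.1 hp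
  have hq : 0 < p ^ (j + 1) := pow_pos hp.pos _
  have hqR : (0 : ℝ) < (p ^ (j + 1) : ℕ) := by exact_mod_cast hq
  by_cases h1 : (p : ℤ) ^ (j + 1) ∣ x
  · have h2 := le_gcd_of_dvd hq (d := p ^ (j + 1)) dvd_rfl (x := x) (by exact_mod_cast h1)
    refine (abs_levelPart_succ_le hp hf0 hfK j x).trans ?_
    exact le_mul_of_one_le_right hK ((one_le_div hqR).2 h2)
  by_cases h2 : (p : ℤ) ^ j ∣ x
  · obtain ⟨u, rfl⟩ := h2
    have hu : ¬ (p : ℤ) ∣ u := fun h => h1 (by rw [pow_succ]; exact mul_dvd_mul_left _ h)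
    set c := f ((p : ℤ) ^ j * u) with hc
    -- all but one of the `p` classes above `x` carry the same value of the conditional mean
    have hE : ∀ b : ℤ, ¬ (p : ℤ) ∣ u + b →
        cosetMean p α f (j + 1) ((p : ℤ) ^ j * u + b * ((p : ℤ) ^ j * 1)) = c := by
      intro b hb
      refine cosetMean_eq_of_const hp fun e => ?_
      rw [hc, ← hf j (u + b + p * e) u (fun h => hb ((dvd_add_left (Dvd.intro _ rfl)).1 h)) hu]
      congr 1; ring
    have hx : cosetMean p α f (j + 1) ((p : ℤ) ^ j * u) = c := by
      have := hE 0 (by simpa using hu)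
      simpa using this
    have hsum := sum_cosetMean_succ hp hper hj (c := 1)
      (fun h => hpp.not_isUnit (isUnit_of_dvd_one h)) ((p : ℤ) ^ j * u)
    have hdiff : (p : ℝ) * levelPart p α f (j + 1) ((p : ℤ) ^ j * u) =
        ∑ b ∈ range p, (c - cosetMean p α f (j + 1)
          ((p : ℤ) ^ j * u + b * ((p : ℤ) ^ j * 1))) := by
      rw [Finset.sum_sub_distrib, hsum, levelPart, hx]
      simp; ring
    have hb : ∀ b ∈ range p, |c - cosetMean p α f (j + 1)
        ((p : ℤ) ^ j * u + b * ((p : ℤ) ^ j * 1))| ≤ K * dvdInd p (b + u) := by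
      intro b _
      by_cases hbu : (p : ℤ) ∣ b + u
      · rw [dvdInd, if_pos hbu, mul_one K, abs_sub_le_iff]
        have e1 := cosetMean_nonneg (p := p) (α := α) hf0 (j + 1)
          ((p : ℤ) ^ j * u + b * ((p : ℤ) ^ j * 1))
        have e2 := cosetMean_le (α := α) hp hfK (j + 1)
          ((p : ℤ) ^ j * u + b * ((p : ℤ) ^ j * 1))
        have e3 := hf0 ((p : ℤ) ^ j * u)
        have e4 := hfK ((p : ℤ) ^ j * u)
        constructor <;> linarith
      · rw [hE b (by rwa [add_comm]), sub_self, abs_zero]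
        exact mul_nonneg hK (dvdInd_nonneg _ _)
    have habs : (p : ℝ) * |levelPart p α f (j + 1) ((p : ℤ) ^ j * u)| ≤ K := by
      rw [show ∀ y : ℝ, (p : ℝ) * |y| = |p * y| from fun y => by rw [abs_mul, abs_of_pos hp0], hdiff]
      refine (Finset.abs_sum_le_sum_abs _ _).trans ((Finset.sum_le_sum hb).trans_eq ?_)
      rw [← Finset.mul_sum, sum_range_add (dvdInd_periodic p), sum_range_dvdInd hp.pos, mul_one]
    have hg := le_gcd_of_dvd hq (d := p ^ j) (pow_dvd_pow p j.le_succ)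
      (x := (p : ℤ) ^ j * u) (by push_cast; exact Dvd.intro _ rfl)
    have hr : 1 / (p : ℝ) ≤ (Int.gcd ((p : ℤ) ^ j * u) (p ^ (j + 1) : ℕ) : ℝ) /
        (p ^ (j + 1) : ℕ) := by
      rw [div_le_div_iff₀ hp0 hqR]
      push_cast at hg ⊢
      rw [one_mul, pow_succ]
      exact mul_le_mul_of_nonneg_right hg hp0.le
    calc |levelPart p α f (j + 1) ((p : ℤ) ^ j * u)| ≤ K * (1 / p) := by
          rw [mul_one_div, le_div_iff₀ hp0, mul_comm]; exact habs
      _ ≤ _ := mul_le_mul_of_nonneg_left hr hK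
  · obtain ⟨v, u, hv, hu, rfl⟩ := exists_eq_pow_mul_of_not_dvd hp h2
    obtain ⟨i, rfl⟩ : ∃ i, j = v + 1 + i := ⟨j - (v + 1), by omega⟩
    rw [levelPart_eq_zero_of_const hp (c := f ((p : ℤ) ^ v * u)), abs_zero]
    · positivity
    · intro b
      rw [← hf v (u + p * (p ^ i * b)) u (fun h => hu ((dvd_add_left (Dvd.intro _ rfl)).1 h)) hu]
      congr 1; ring

/-- The analogue of `abs_levelPart_le_of_odd` when `f (2 ^ v * u)` with `u` odd depends on `u` modulo
`4`: the component of level `2 ^ (j + 1)` vanishes off the multiples of `2 ^ (j - 1)`. -/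
theorem abs_levelPart_le_of_two (hf0 : ∀ x, 0 ≤ f x) (hfK : ∀ x, f x ≤ K)
    (hf : ∀ v u u', ¬ (2 : ℤ) ∣ u → 4 ∣ u' - u → f ((2 : ℤ) ^ v * u) = f ((2 : ℤ) ^ v * u'))
    (j : ℕ) (x : ℤ) :
    |levelPart 2 α f (j + 1) x| ≤ 4 * K * (Int.gcd x (2 ^ (j + 1) : ℕ) / (2 ^ (j + 1) : ℕ)) := by
  have hK : 0 ≤ K := (hf0 0).trans (hfK 0)
  have hq : 0 < 2 ^ (j + 1) := by positivity
  have hqR : (0 : ℝ) < (2 ^ (j + 1) : ℕ) := by exact_mod_cast hq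
  by_cases h1 : (2 : ℤ) ^ (j - 1) ∣ x
  · have hg := le_gcd_of_dvd hq (d := 2 ^ (j - 1)) (pow_dvd_pow 2 (by omega))
      (x := x) (by push_cast; exact h1)
    have hle : ((2 ^ (j + 1) : ℕ) : ℝ) ≤ 4 * (2 ^ (j - 1) : ℕ) := by
      have : 2 ^ (j + 1) ≤ 2 ^ (2 + (j - 1)) := Nat.pow_le_pow_right (by norm_num) (by omega)
      rw [pow_add 2 2 (j - 1)] at this
      exact_mod_cast this
    have hr : 1 ≤ 4 * ((Int.gcd x (2 ^ (j + 1) : ℕ) : ℝ) / (2 ^ (j + 1) : ℕ)) := by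
      rw [mul_div_assoc', one_le_div hqR]; linarith
    refine (abs_levelPart_succ_le Nat.prime_two hf0 hfK j x).trans ?_
    nlinarith
  · obtain ⟨v, u, hv, hu, rfl⟩ := exists_eq_pow_mul_of_not_dvd Nat.prime_two h1
    obtain ⟨i, rfl⟩ : ∃ i, j = v + 2 + i := ⟨j - (v + 2), by omega⟩
    rw [levelPart_eq_zero_of_const Nat.prime_two (c := f ((2 : ℤ) ^ v * u)), abs_zero]
    · positivity
    · intro b
      rw [hf v u (u + 4 * (2 ^ i * b)) hu ⟨2 ^ i * b, by ring⟩]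
      congr 1; push_cast; ring

end LevelPartBound

/-- The indicator function of the sums of two squares modulo `p ^ α`, normalised to mean `1`. -/
noncomputable def normInd (α p : ℕ) (x : ℤ) : ℝ := ssInd p α x / densityMod {0} p α

theorem normInd_periodic (α p : ℕ) : Periodic (normInd α p) ((p ^ α : ℕ) : ℤ) :=
  (ssInd_periodic p α).comp (· / densityMod {0} p α)

theorem normInd_nonneg (α p : ℕ) (x : ℤ) : 0 ≤ normInd α p x :=
  div_nonneg (ssInd_nonneg _ _ _) (densityMod_nonneg _ _ _)

theorem inv_densityMod_le {p α : ℕ} (hp : p.Prime) (hα : 2 ≤ α) :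
    (densityMod {0} p α)⁻¹ ≤ 1 + 6 / p := by
  have hp2 : (2 : ℝ) ≤ p := by exact_mod_cast hp.two_le
  have h4 := quarter_le_densityMod hp hα
  by_cases h2 : p = 2
  · subst h2
    calc (densityMod {0} 2 α)⁻¹ ≤ (1 / 4)⁻¹ := inv_anti₀ (by norm_num) h4
      _ ≤ _ := by norm_num
  · have h5 := one_sub_inv_le_densityMod hp h2 (by omega : 1 ≤ α)
    rw [inv_le_comm₀ (by linarith) (by positivity)]
    refine le_trans ?_ h5
    rw [inv_le_comm₀ (by positivity) (by rw [sub_pos, div_lt_one (by linarith)]; linarith)]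
    have : 1 - 1 / (p : ℝ) = (p - 1) / p := by field_simp
    rw [this, inv_div, div_le_iff₀ (by linarith)]
    field_simp
    nlinarith

theorem normInd_le {p α : ℕ} (hp : p.Prime) (hα : 2 ≤ α) (x : ℤ) :
    normInd α p x ≤ 1 + 6 / p := by
  refine le_trans ?_ (inv_densityMod_le hp hα)
  rw [normInd, div_eq_mul_inv]
  exact mul_le_of_le_one_left (inv_nonneg.2 (densityMod_nonneg _ _ _)) (ssInd_le_one _ _ _)

theorem normInd_le_four {p α : ℕ} (hp : p.Prime) (hα : 2 ≤ α) (x : ℤ) : normInd α p x ≤ 4 := by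
  refine (normInd_le hp hα x).trans ?_
  have hp2 : (2 : ℝ) ≤ p := by exact_mod_cast hp.two_le
  have : 6 / (p : ℝ) ≤ 6 / 2 := by gcongr
  linarith

theorem levelPart_normInd_zero {p α : ℕ} (hp : p.Prime) (hα : 2 ≤ α) (x : ℤ) :
    levelPart p α (normInd α p) 0 x = 1 := by
  have h4 := quarter_le_densityMod hp hα
  have hp0 : (p : ℝ) ^ α ≠ 0 := pow_ne_zero _ (by exact_mod_cast hp.ne_zero)
  have h1 := sum_range_add (normInd_periodic α p) x
  have h2 : ∑ y ∈ range (p ^ α), normInd α p y = (p : ℝ) ^ α := by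
    simp only [normInd]
    rw [← Finset.sum_div, sum_ssInd hp]
    field_simp
  rw [h2] at h1
  simp only [levelPart, cosetMean, pow_zero, one_mul, Nat.sub_zero, add_comm x]
  rw [h1, div_self hp0]

theorem abs_levelPart_normInd_le {p α : ℕ} (hp : p.Prime) (hα : 2 ≤ α) {j : ℕ} (hj : j ≤ α)
    (x : ℤ) : |levelPart p α (normInd α p) j x| ≤
      (if j = 0 then 1 else 16) * (Int.gcd x (p ^ j : ℕ) / (p ^ j : ℕ)) := by
  cases j with
  | zero => rw [levelPart_normInd_zero hp hα]; simp
  | succ j =>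
    rw [if_neg j.succ_ne_zero]
    by_cases h2 : p = 2
    · subst h2
      have := abs_levelPart_le_of_two (α := α) (normInd_nonneg α 2) (normInd_le_four hp hα)
        (fun v u u' hu huu' => by simp only [normInd]; rw [ssInd_transfer_two α v hu huu']) j x
      norm_num at this ⊢
      exact this
    · have := abs_levelPart_le_of_odd hp (normInd_periodic α p) (normInd_nonneg α p)
        (normInd_le_four hp hα)
        (fun v u u' hu hu' => by simp only [normInd]; rw [ssInd_transfer_odd hp h2 α v hu hu'])
        (by omega : j < α) x
      refine this.trans (mul_le_mul_of_nonneg_right (by norm_num) (by positivity))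

/-! ### Moments in short intervals -/

theorem prodLevelPart_normInd_one {P : Finset ℕ} (hP : ∀ p ∈ P, p.Prime) {α : ℕ} (hα : 2 ≤ α)
    (x : ℤ) : prodLevelPart P α (normInd α) 1 x = 1 := by
  refine Finset.prod_eq_one fun p hp => ?_
  rw [Nat.factorization_one]
  exact levelPart_normInd_zero (hP p hp) hα x

theorem prod_gcd_le {P : Finset ℕ} (hP : ∀ p ∈ P, p.Prime) {q : ℕ} (hq : q ≠ 0) (x : ℤ) :
    ∏ p ∈ P, (Int.gcd x (p ^ q.factorization p : ℕ) : ℝ) ≤ Int.gcd x q := by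
  have h : ∏ p ∈ P, Int.gcd x (p ^ q.factorization p : ℕ) ∣ Int.gcd x q := by
    refine Finset.prod_dvd_of_isRelPrime ?_ fun p hp => ?_
    · intro p hp l hl hpl
      rw [onFun, ← Nat.coprime_iff_isRelPrime]
      have h0 := (Nat.coprime_primes (hP p hp) (hP l hl)).2 hpl
      exact Nat.Coprime.of_dvd (Int.gcd_dvd_natAbs_right _ _) (Int.gcd_dvd_natAbs_right _ _)
        (Nat.Coprime.pow _ _ h0)
    · exact Int.gcd_dvd_gcd_of_dvd_right _ (Int.natCast_dvd_natCast.2 (Nat.ordProj_dvd q p))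
  exact_mod_cast Nat.le_of_dvd (Int.gcd_pos_of_ne_zero_right _ (by exact_mod_cast hq)) h

theorem abs_prodLevelPart_normInd_le {P : Finset ℕ} (hP : ∀ p ∈ P, p.Prime) {α : ℕ} (hα : 2 ≤ α)
    {q : ℕ} (hq : q ∣ ∏ p ∈ P, p ^ α) (x : ℤ) :
    |prodLevelPart P α (normInd α) q x| ≤
      (∏ p ∈ P, if q.factorization p = 0 then (1 : ℝ) else 16) * (Int.gcd x q / q) := by
  have hq0 : q ≠ 0 := (Nat.pos_of_dvd_of_pos hq (prod_pow_pos hP α)).ne'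
  have hV0 : 0 ≤ ∏ p ∈ P, if q.factorization p = 0 then (1 : ℝ) else 16 :=
    Finset.prod_nonneg fun p _ => by split_ifs <;> norm_num
  have hqe : (∏ p ∈ P, ((p ^ q.factorization p : ℕ) : ℝ)) = q := by
    rw [← Nat.cast_prod,
      prod_pow_factorization_of_subset hq0 (primeFactors_subset_of_dvd_prod_pow hP hq)]
  calc |prodLevelPart P α (normInd α) q x|
      ≤ ∏ p ∈ P, ((if q.factorization p = 0 then (1 : ℝ) else 16) *
          (Int.gcd x (p ^ q.factorization p : ℕ) / (p ^ q.factorization p : ℕ))) := by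
        rw [prodLevelPart, Finset.abs_prod]
        exact Finset.prod_le_prod (fun _ _ => abs_nonneg _) fun p hp =>
          abs_levelPart_normInd_le (hP p hp) hα (factorization_le_of_dvd_prod_pow hP hq hp) x
    _ = (∏ p ∈ P, if q.factorization p = 0 then (1 : ℝ) else 16) *
          ((∏ p ∈ P, (Int.gcd x (p ^ q.factorization p : ℕ) : ℝ)) / q) := by
        rw [Finset.prod_mul_distrib, Finset.prod_div_distrib, hqe]
    _ ≤ _ := by
        have := prod_gcd_le hP hq0 x
        gcongr

/-- The Euler factor at `p` of the sum over `r` in `abs_moment_le`, bounded uniformly in `α`. -/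
theorem exists_local_sum_le (m : ℕ) : ∃ C : ℝ, 0 ≤ C ∧ ∀ p : ℕ, 2 ≤ p → ∀ α : ℕ,
    ∑ j ∈ range (α + 1), ((if j = 0 then (1 : ℝ) else 16) * ((j : ℝ) + 1) ^ 2) ^ m /
      (p : ℝ) ^ j ≤ 1 + C / p := by
  have hs : Summable fun n : ℕ => (n : ℝ) ^ (2 * m) * (1 / 2 : ℝ) ^ n :=
    summable_pow_mul_geometric_of_norm_lt_one _ (by norm_num)
  have hs2 : Summable fun n : ℕ => ((n + 2 : ℕ) : ℝ) ^ (2 * m) * (1 / 2 : ℝ) ^ (n + 2) :=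
    (summable_nat_add_iff 2).2 hs
  set S := ∑' n : ℕ, ((n + 2 : ℕ) : ℝ) ^ (2 * m) * (1 / 2 : ℝ) ^ (n + 2) with hS
  have hS0 : 0 ≤ S := tsum_nonneg fun n => by positivity
  refine ⟨16 ^ m * 4 * S, by positivity, fun p hp α => ?_⟩
  have hp2 : (2 : ℝ) ≤ p := by exact_mod_cast hp
  have hp0 : (0 : ℝ) < p := by linarith
  rw [Finset.sum_range_succ', add_comm]
  refine add_le_add (by simp) ?_
  calc ∑ j ∈ range α, ((if j + 1 = 0 then (1 : ℝ) else 16) * (((j + 1 : ℕ) : ℝ) + 1) ^ 2) ^ m /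
        (p : ℝ) ^ (j + 1)
      ≤ ∑ j ∈ range α, 16 ^ m * 4 / p *
          (((j + 2 : ℕ) : ℝ) ^ (2 * m) * (1 / 2 : ℝ) ^ (j + 2)) := by
        refine Finset.sum_le_sum fun j _ => ?_
        rw [if_neg j.succ_ne_zero, mul_pow, ← pow_mul]
        have h1 : 1 / (p : ℝ) ^ (j + 1) ≤ 1 / p * (4 * (1 / 2 : ℝ) ^ (j + 2)) := by
          have e : (4 : ℝ) * (1 / 2 : ℝ) ^ (j + 2) = 1 / 2 ^ j := by
            rw [pow_add, one_div_pow]; ring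
          rw [e, pow_succ, one_div_mul_one_div, mul_comm (p : ℝ)]
          gcongr
        have e2 : ((j + 1 : ℕ) : ℝ) + 1 = ((j + 2 : ℕ) : ℝ) := by push_cast; ring
        rw [e2, div_eq_mul_one_div]
        calc (16 : ℝ) ^ m * ((j + 2 : ℕ) : ℝ) ^ (2 * m) * (1 / (p : ℝ) ^ (j + 1))
            ≤ 16 ^ m * ((j + 2 : ℕ) : ℝ) ^ (2 * m) * (1 / p * (4 * (1 / 2 : ℝ) ^ (j + 2))) :=
              mul_le_mul_of_nonneg_left h1 (by positivity)
          _ = _ := by ring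
    _ ≤ 16 ^ m * 4 / p * S := by
        rw [← Finset.mul_sum]
        exact mul_le_mul_of_nonneg_left (hs2.sum_le_tsum _ fun n _ => by positivity)
          (by positivity)
    _ = _ := by ring

/-- The moments of short interval sums of the normalised indicator function of the sums of two
squares, with an Euler product in place of a power of `h`. -/
theorem exists_moment_le (m : ℕ) : ∃ C : ℝ, 0 ≤ C ∧ ∀ P : Finset ℕ, (∀ p ∈ P, p.Prime) →
    ∀ α : ℕ, 2 ≤ α → ∀ h : ℕ,
    |∑ x ∈ range (∏ p ∈ P, p ^ α), (shiftSum h (fun y => ∏ p ∈ P, normInd α p y - 1) x) ^ m| ≤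
      (∏ p ∈ P, p ^ α : ℕ) * (√(2 * h) ^ m * ∏ p ∈ P, (1 + C / p)) := by
  obtain ⟨C, hC0, hC⟩ := exists_local_sum_le m
  refine ⟨C, hC0, fun P hP α hα h => ?_⟩
  set N := ∏ p ∈ P, p ^ α with hN
  have hN0 : 0 < N := prod_pow_pos hP α
  set V : ℕ → ℝ := fun q => ∏ p ∈ P, if q.factorization p = 0 then (1 : ℝ) else 16 with hV
  have hper : ∀ p ∈ P, Periodic (normInd α p) ((p ^ α : ℕ) : ℤ) := fun p _ =>
    normInd_periodic α p
  have hF : (fun y : ℤ => ∏ p ∈ P, normInd α p y - 1) =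
      fun y => ∑ q ∈ N.divisors.erase 1, prodLevelPart P α (normInd α) q y := by
    funext y
    have h1 : 1 ∈ N.divisors := Nat.one_mem_divisors.2 hN0.ne'
    rw [← sum_prodLevelPart hP α (normInd α) y, ← Finset.add_sum_erase _ _ h1,
      prodLevelPart_normInd_one hP hα]
    ring
  have hmono : ∀ q r, q ∣ r → r ∣ N → V q ≤ V r := by
    intro q r hqr hrN
    have hr0 := (Nat.pos_of_dvd_of_pos hrN hN0)
    have hq0 := Nat.pos_of_dvd_of_pos hqr hr0
    refine Finset.prod_le_prod (fun p _ => by split_ifs <;> norm_num) fun p _ => ?_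
    have hle := (Nat.factorization_le_iff_dvd hq0.ne' hr0.ne').2 hqr p
    by_cases h1 : r.factorization p = 0
    · rw [if_pos h1, if_pos (by omega)]
    · rw [if_neg h1]; split_ifs <;> norm_num
  rw [hF]
  refine (abs_moment_le hN0 (fun q hq => prodLevelPart_isPrimitive hP hper hq)
    (fun q => Finset.prod_nonneg fun p _ => by split_ifs <;> norm_num)
    (fun q hq x => abs_prodLevelPart_normInd_le hP hα hq x) hmono m h).trans ?_
  refine mul_le_mul_of_nonneg_left (mul_le_mul_of_nonneg_left ?_ (by positivity)) (by positivity)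
  calc ∑ r ∈ N.divisors, (V r * (r.divisors.card : ℝ) ^ 2) ^ m / r
      = ∑ r ∈ N.divisors, ∏ p ∈ P, ((if r.factorization p = 0 then (1 : ℝ) else 16) *
          ((r.factorization p : ℝ) + 1) ^ 2) ^ m / (p : ℝ) ^ r.factorization p := by
        refine Finset.sum_congr rfl fun r hr => ?_
        have hrN := Nat.dvd_of_mem_divisors hr
        have hr0 := (Nat.pos_of_mem_divisors hr).ne'
        have hsub := primeFactors_subset_of_dvd_prod_pow hP hrN
        have e1 : (r : ℝ) = ∏ p ∈ P, (p : ℝ) ^ r.factorization p := by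
          conv_lhs => rw [← prod_pow_factorization_of_subset hr0 hsub]
          push_cast; rfl
        have e2 : (r.divisors.card : ℝ) = ∏ p ∈ P, ((r.factorization p : ℝ) + 1) := by
          rw [card_divisors_of_subset hr0 hsub]; push_cast; rfl
        rw [Finset.prod_div_distrib, ← e1, Finset.prod_pow, Finset.prod_mul_distrib,
          Finset.prod_pow, ← e2]
    _ = ∏ p ∈ P, ∑ j ∈ range (α + 1), ((if j = 0 then (1 : ℝ) else 16) *
          ((j : ℝ) + 1) ^ 2) ^ m / (p : ℝ) ^ j :=
        sum_divisors_prod_pow hP α fun p j => ((if j = 0 then (1 : ℝ) else 16) *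
          ((j : ℝ) + 1) ^ 2) ^ m / (p : ℝ) ^ j
    _ ≤ ∏ p ∈ P, (1 + C / p) := by
        refine Finset.prod_le_prod (fun p _ => Finset.sum_nonneg fun j _ => ?_)
          fun p hp => hC p (hP p hp).two_le α
        refine div_nonneg (pow_nonneg (mul_nonneg ?_ (sq_nonneg _)) _) (by positivity)
        split_ifs <;> norm_num

/-! ### Euler products of small dimension and elementary symmetric functions -/

theorem pow_dvd_factorial_mul {p : ℕ} (hp : 0 < p) (k : ℕ) : p ^ k ∣ (p * k).factorial := by
  induction k with
  | zero => simp
  | succ k ih =>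
    have e : p * (k + 1) = (p * k + p - 1) + 1 := by rw [Nat.mul_succ]; omega
    rw [pow_succ, mul_comm, e, Nat.factorial_succ, ← e]
    exact mul_dvd_mul (Dvd.intro _ rfl) (ih.trans (Nat.factorial_dvd_factorial (by omega)))

/-- The upper bound in Mertens' first theorem, from the prime factorisation of `n !`. -/
theorem sum_log_div_le {n : ℕ} (hn : 1 ≤ n) {P : Finset ℕ} (hP : ∀ p ∈ P, p.Prime)
    (hPn : ∀ p ∈ P, p ≤ n) :
    ∑ p ∈ P, Real.log p / p ≤ Real.log n + Real.log 4 := by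
  have hn0 : (0 : ℝ) < n := by exact_mod_cast hn
  have h1 : ∏ p ∈ P, p ^ (n / p) ∣ n.factorial := by
    refine Finset.prod_dvd_of_isRelPrime ?_ fun p hp => ?_
    · intro p hp l hl hpl
      rw [onFun, ← Nat.coprime_iff_isRelPrime]
      exact Nat.Coprime.pow _ _ ((Nat.coprime_primes (hP p hp) (hP l hl)).2 hpl)
    · exact (pow_dvd_factorial_mul (hP p hp).pos _).trans
        (Nat.factorial_dvd_factorial (Nat.mul_div_le n p))
  have h2 : ∏ p ∈ P, p ^ (n / p) ≤ n ^ n :=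
    (Nat.le_of_dvd (Nat.factorial_pos n) h1).trans (Nat.factorial_le_pow n)
  have h3 : ∑ p ∈ P, ((n / p : ℕ) : ℝ) * Real.log p ≤ n * Real.log n := by
    have h4 : Real.log ((∏ p ∈ P, p ^ (n / p) : ℕ) : ℝ) ≤ Real.log ((n ^ n : ℕ) : ℝ) := by
      refine Real.log_le_log ?_ (by exact_mod_cast h2)
      exact_mod_cast Finset.prod_pos fun p hp => pow_pos (hP p hp).pos _
    push_cast at h4
    rw [Real.log_pow, Real.log_prod fun p hp =>
      pow_ne_zero _ (by exact_mod_cast (hP p hp).ne_zero)] at h4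
    simpa only [Real.log_pow] using h4
  have h5 : ∑ p ∈ P, Real.log p ≤ Real.log 4 * n := by
    refine le_trans ?_ (Chebyshev.theta_le_log4_mul_x hn0.le)
    rw [Chebyshev.theta, Nat.floor_natCast]
    refine Finset.sum_le_sum_of_subset_of_nonneg ?_ fun p _ _ => Real.log_natCast_nonneg p
    intro p hp
    simp [hP p hp, hPn p hp, (hP p hp).pos]
  have h6 : n * ∑ p ∈ P, Real.log p / p ≤
      ∑ p ∈ P, ((n / p : ℕ) : ℝ) * Real.log p + ∑ p ∈ P, Real.log p := by
    rw [Finset.mul_sum, ← Finset.sum_add_distrib]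
    refine Finset.sum_le_sum fun p hp => ?_
    have hlog : 0 ≤ Real.log p := Real.log_natCast_nonneg p
    have hp0 : (0 : ℝ) < p := by exact_mod_cast (hP p hp).pos
    have h7 : (n : ℝ) / p ≤ (n / p : ℕ) + 1 := by
      rw [div_le_iff₀ hp0]
      have := (Nat.lt_mul_div_succ n (hP p hp).pos).le
      have h8 : (n : ℝ) ≤ p * ((n / p : ℕ) + 1) := by exact_mod_cast this
      linarith
    calc (n : ℝ) * (Real.log p / p) = n / p * Real.log p := by ring
      _ ≤ ((n / p : ℕ) + 1) * Real.log p := mul_le_mul_of_nonneg_right h7 hlog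
      _ = _ := by ring
  have h9 : n * ∑ p ∈ P, Real.log p / p ≤ n * (Real.log n + Real.log 4) := by linarith
  exact le_of_mul_le_mul_left h9 hn0

/-- Euler products of fixed dimension over the primes up to `n` are smaller than any power
of `n`. -/
theorem exists_prod_one_add_div_le {c δ : ℝ} (hc : 0 ≤ c) (hδ : 0 < δ) : ∃ C : ℝ, 0 < C ∧
    ∀ n : ℕ, 1 ≤ n → ∀ P : Finset ℕ, (∀ p ∈ P, p.Prime) → (∀ p ∈ P, p ≤ n) →
    ∏ p ∈ P, (1 + c / p) ≤ C * (n : ℝ) ^ δ := by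
  -- the primes below a threshold `z` contribute a constant, the others are weighted by `log p`
  obtain ⟨z, hz⟩ := exists_nat_ge (Real.exp (c / δ + 1))
  have hz0 : (0 : ℝ) < z := (Real.exp_pos _).trans_le hz
  have hlogz : c / δ + 1 ≤ Real.log z := (Real.le_log_iff_exp_le hz0).2 hz
  have hcδ : 0 ≤ c / δ := by positivity
  have hL : 0 < Real.log z := by linarith
  have hcL : c / Real.log z ≤ δ := by
    rw [div_le_iff₀ hL]
    have : c = δ * (c / δ) := by field_simp
    nlinarith
  refine ⟨Real.exp (c * z + c * (Real.log 4 / Real.log z)), Real.exp_pos _,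
    fun n hn P hP hPn => ?_⟩
  have hn0 : (0 : ℝ) < n := by exact_mod_cast hn
  have hn1 : (1 : ℝ) ≤ n := by exact_mod_cast hn
  have h1 : ∑ p ∈ P, 1 / (p : ℝ) ≤ z + (Real.log n + Real.log 4) / Real.log z := by
    have h2 : ∀ p ∈ P, 1 / (p : ℝ) ≤ (if p < z then 1 else 0) +
        Real.log p / p / Real.log z := by
      intro p hp
      have hp1 : (1 : ℝ) ≤ p := by exact_mod_cast (hP p hp).one_lt.le
      have hp0 : (0 : ℝ) < p := by linarith
      have hlog : 0 ≤ Real.log p / p / Real.log z := by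
        have := Real.log_natCast_nonneg p
        positivity
      split_ifs with hpz
      · have : 1 / (p : ℝ) ≤ 1 := (div_le_one hp0).2 hp1
        linarith
      · have hpz' : (z : ℝ) ≤ p := by exact_mod_cast not_lt.1 hpz
        have := Real.log_le_log hz0 hpz'
        rw [zero_add, div_div, div_le_div_iff₀ hp0 (by positivity)]
        nlinarith
    have h3 : ∑ p ∈ P, (if p < z then (1 : ℝ) else 0) ≤ z := by
      rw [Finset.sum_boole]
      have : (P.filter (· < z)).card ≤ (range z).card := by
        refine card_le_card fun p hp => ?_
        simpa using (Finset.mem_filter.1 hp).2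
      rw [card_range] at this
      exact_mod_cast this
    refine (Finset.sum_le_sum h2).trans ?_
    rw [Finset.sum_add_distrib, ← Finset.sum_div]
    refine add_le_add h3 (div_le_div_of_nonneg_right (sum_log_div_le hn hP hPn) hL.le)
  calc ∏ p ∈ P, (1 + c / p) ≤ ∏ p ∈ P, Real.exp (c * (1 / p)) := by
        refine Finset.prod_le_prod (fun p _ => by positivity) fun p _ => ?_
        have := Real.add_one_le_exp (c * (1 / (p : ℝ)))
        rw [mul_one_div] at this ⊢
        linarith
    _ = Real.exp (c * ∑ p ∈ P, 1 / (p : ℝ)) := by rw [← Real.exp_sum, Finset.mul_sum]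
    _ ≤ Real.exp (c * z + c * (Real.log 4 / Real.log z) + Real.log n * δ) := by
        refine Real.exp_le_exp.2 ((mul_le_mul_of_nonneg_left h1 hc).trans ?_)
        have h4 := mul_le_mul_of_nonneg_left hcL (Real.log_natCast_nonneg n)
        have e : c * (z + (Real.log n + Real.log 4) / Real.log z) =
          c * z + c * (Real.log 4 / Real.log z) + Real.log n * (c / Real.log z) := by ring
        rw [e]; linarith
    _ = _ := by rw [Real.exp_add, Real.rpow_def_of_pos hn0]

/-- Newton's identities bound the elementary symmetric functions by the power sums. -/
theorem abs_sum_powersetCard_le {ι : Type*} (s : Finset ι) (a : ι → ℝ) {W : ℝ}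
    (hW : ∀ j, 1 ≤ j → |∑ i ∈ s, a i ^ j| ≤ W ^ j) (k : ℕ) :
    |∑ T ∈ s.powersetCard k, ∏ i ∈ T, a i| ≤ W ^ k := by
  classical
  have hW0 : 0 ≤ W := by
    have := hW 1 le_rfl
    rw [pow_one] at this
    exact (abs_nonneg _).trans this
  set E : ℕ → ℝ := fun k => ∑ T ∈ s.powersetCard k, ∏ i ∈ T, a i with hE
  have hesymm : ∀ k, MvPolynomial.aeval (fun i : s => a i) (MvPolynomial.esymm s ℝ k) = E k := by
    intro k
    rw [MvPolynomial.aeval_esymm_eq_multiset_esymm]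
    refine Eq.trans ?_ (Finset.esymm_map_val a s k)
    congr 1
    exact Multiset.attach_map_val' s.val a
  have hpsum : ∀ j, MvPolynomial.aeval (fun i : s => a i) (MvPolynomial.psum s ℝ j) =
      ∑ i ∈ s, a i ^ j := by
    intro j
    simp only [MvPolynomial.psum, map_sum, map_pow, MvPolynomial.aeval_X]
    exact Finset.sum_coe_sort s fun i => a i ^ j
  have hnewton : ∀ k : ℕ, (k : ℝ) * E k = (-1) ^ (k + 1) *
      ∑ z ∈ antidiagonal k with z.1 < k, (-1) ^ z.1 * E z.1 * ∑ i ∈ s, a i ^ z.2 := by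
    intro k
    have := congrArg (MvPolynomial.aeval (fun i : s => a i))
      (MvPolynomial.mul_esymm_eq_sum s ℝ k)
    simp only [map_mul, map_natCast, map_sum, map_pow, map_neg, map_one, hesymm, hpsum] at this
    exact this
  change |E k| ≤ W ^ k
  induction k using Nat.strong_induction_on with
  | _ k ih =>
    rcases Nat.eq_zero_or_pos k with rfl | hk
    · simp [hE]
    have hk0 : (0 : ℝ) < k := by exact_mod_cast hk
    refine le_of_mul_le_mul_left ?_ hk0
    calc (k : ℝ) * |E k| = |(k : ℝ) * E k| := by rw [abs_mul, abs_of_pos hk0]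
      _ = |∑ z ∈ antidiagonal k with z.1 < k,
          (-1) ^ z.1 * E z.1 * ∑ i ∈ s, a i ^ z.2| := by
          rw [hnewton, abs_mul]
          simp
      _ ≤ ∑ z ∈ antidiagonal k with z.1 < k, W ^ k := by
          refine (Finset.abs_sum_le_sum_abs _ _).trans (Finset.sum_le_sum fun z hz => ?_)
          obtain ⟨hz1, hz2⟩ := Finset.mem_filter.1 hz
          rw [HasAntidiagonal.mem_antidiagonal] at hz1
          rw [abs_mul, abs_mul, abs_pow, abs_neg, abs_one, one_pow, one_mul, ← hz1, pow_add]
          exact mul_le_mul (ih z.1 hz2) (hW z.2 (by omega)) (abs_nonneg _) (by positivity)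
      _ = k * W ^ k := by
          rw [Finset.sum_filter, Finset.Nat.sum_antidiagonal_eq_sum_range_succ_mk,
            Finset.sum_range_succ, if_neg (lt_irrefl k), add_zero,
            Finset.sum_congr rfl fun i hi => if_pos (mem_range.1 hi)]
          simp

/-! ### The truncated singular series as a mean value -/

theorem sum_range_prod_eq_prod_sum {P : Finset ℕ} (hP : ∀ p ∈ P, p.Prime) (α : ℕ)
    {φ : ℕ → ℤ → ℝ} (hφ : ∀ p ∈ P, Periodic (φ p) ((p ^ α : ℕ) : ℤ)) :
    ∑ x ∈ range (∏ p ∈ P, p ^ α), ∏ p ∈ P, φ p x = ∏ p ∈ P, ∑ x ∈ range (p ^ α), φ p x := by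
  induction P using Finset.induction_on with
  | empty => simp
  | insert p P hpP ih =>
    have hp : p.Prime := hP p (mem_insert_self _ _)
    have hP' : ∀ l ∈ P, l.Prime := fun l hl => hP l (mem_insert_of_mem hl)
    have hφ' : ∀ l ∈ P, Periodic (φ l) ((l ^ α : ℕ) : ℤ) := fun l hl =>
      hφ l (mem_insert_of_mem hl)
    have hφp := hφ p (mem_insert_self _ _)
    have hcop := coprime_pow_prod hP' hp hpP (fun _ => α) α
    have hA : 0 < p ^ α := pow_pos hp.pos α
    have hB := prod_pow_pos hP' α
    have hdvd : ∀ l ∈ P, l ^ α ∣ ∏ l ∈ P, l ^ α := fun l hl => Finset.dvd_prod_of_mem _ hl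
    rw [Finset.prod_insert hpP, Finset.prod_insert hpP, ← ih hP' hφ']
    set A := p ^ α with hAdef
    set B := ∏ l ∈ P, l ^ α with hBdef
    have hper : Periodic (fun x => ∏ l ∈ insert p P, φ l x) ((A * B : ℕ) : ℤ) := by
      intro x
      refine Finset.prod_congr rfl fun l hl => ?_
      rcases Finset.mem_insert.1 hl with rfl | hl
      · exact periodic_of_dvd hφp (Dvd.intro _ rfl) x
      · exact periodic_of_dvd (hφ' l hl) ((hdvd l hl).mul_left _) x
    have hPper : Periodic (fun x => ∏ l ∈ P, φ l x) ((B : ℕ) : ℤ) := fun x =>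
      Finset.prod_congr rfl fun l hl => periodic_of_dvd (hφ' l hl) (hdvd l hl) x
    have hAB : IsCoprime (A : ℤ) (B : ℤ) := Nat.isCoprime_iff_coprime.2 hcop
    rw [← sum_range_crt_of_dvd hcop hA hB dvd_rfl dvd_rfl hper]
    have h1 := sum_range_add_mul hφp 0 B hAB
    have h2 := sum_range_add_mul hPper 0 A hAB.symm
    rw [← h1, ← h2, Finset.sum_mul_sum, Finset.sum_comm]
    refine Finset.sum_congr rfl fun v _ => Finset.sum_congr rfl fun u _ => ?_
    rw [Finset.prod_insert hpP]
    congr 1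
    · exact eq_of_dvd_sub hφp ⟨u, by ring⟩
    · exact eq_of_dvd_sub hPper ⟨v, by ring⟩

/-- The singular series with its Euler product restricted to `P` and its local densities computed
modulo `p ^ α`. -/
noncomputable def truncSeries (P : Finset ℕ) (α : ℕ) (T : Finset ℤ) : ℝ :=
  ∏ p ∈ P, densityMod T p α / densityMod {0} p α ^ T.card

theorem sum_prod_normInd {P : Finset ℕ} (hP : ∀ p ∈ P, p.Prime) (α : ℕ) (T : Finset ℤ) :
    ∑ x ∈ range (∏ p ∈ P, p ^ α), ∏ t ∈ T, ∏ p ∈ P, normInd α p (x + t) =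
      (∏ p ∈ P, p ^ α : ℕ) * truncSeries P α T := by
  have h1 : ∀ x : ℤ, ∏ t ∈ T, ∏ p ∈ P, normInd α p (x + t) =
      ∏ p ∈ P, ∏ t ∈ T, normInd α p (x + t) := fun x => Finset.prod_comm
  have hper : ∀ p ∈ P, Periodic (fun x : ℤ => ∏ t ∈ T, normInd α p (x + t))
      ((p ^ α : ℕ) : ℤ) := by
    intro p _ x
    refine Finset.prod_congr rfl fun t _ => ?_
    rw [← normInd_periodic α p (x + t)]; congr 1; ring
  simp only [h1]
  rw [sum_range_prod_eq_prod_sum hP α hper, truncSeries, Nat.cast_prod, ← Finset.prod_mul_distrib]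
  refine Finset.prod_congr rfl fun p hp => ?_
  have hp0 : (p : ℝ) ^ α ≠ 0 := pow_ne_zero _ (by exact_mod_cast (hP p hp).ne_zero)
  simp only [normInd, Finset.prod_div_distrib, Finset.prod_const]
  rw [← Finset.sum_div, densityMod_eq T]
  push_cast
  field_simp

/-- The alternating sum over the subsets of `H` is the expansion of a product of differences. -/
theorem sum_prod_normInd_sub_one {P : Finset ℕ} (hP : ∀ p ∈ P, p.Prime) (α : ℕ) (H : Finset ℤ) :
    ∑ x ∈ range (∏ p ∈ P, p ^ α), ∏ t ∈ H, (∏ p ∈ P, normInd α p (x + t) - 1) =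
      (∏ p ∈ P, p ^ α : ℕ) *
        ∑ T ∈ H.powerset, (-1 : ℝ) ^ (H \ T).card * truncSeries P α T := by
  simp only [sub_eq_add_neg, Finset.prod_add, Finset.prod_const]
  rw [Finset.sum_comm, Finset.mul_sum]
  refine Finset.sum_congr rfl fun T _ => ?_
  rw [← Finset.sum_mul, sum_prod_normInd hP]
  ring

theorem prod_normInd_le {P : Finset ℕ} (hP : ∀ p ∈ P, p.Prime) {α : ℕ} (hα : 2 ≤ α) (x : ℤ) :
    |∏ p ∈ P, normInd α p x - 1| ≤ ∏ p ∈ P, (1 + 6 / (p : ℝ)) := by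
  have h1 : ∏ p ∈ P, normInd α p x ≤ ∏ p ∈ P, (1 + 6 / (p : ℝ)) :=
    Finset.prod_le_prod (fun p _ => normInd_nonneg α p x) fun p hp => normInd_le (hP p hp) hα x
  have h2 : 0 ≤ ∏ p ∈ P, normInd α p x := Finset.prod_nonneg fun p _ => normInd_nonneg α p x
  have h3 : 1 ≤ ∏ p ∈ P, (1 + 6 / (p : ℝ)) := Finset.one_le_prod fun p _ => by
    have : 0 ≤ 6 / (p : ℝ) := by positivity
    linarith
  rw [abs_sub_le_iff]
  constructor <;> linarith

theorem sum_Icc_eq_shiftSum (h : ℕ) (G : ℤ → ℝ) (x : ℤ) :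
    ∑ n ∈ Icc (1 : ℤ) h, G (x + n) = shiftSum h G x := by
  unfold shiftSum
  symm
  refine Finset.sum_nbij' (fun n : ℕ => (n : ℤ) + 1) (fun n : ℤ => (n - 1).toNat) ?_ ?_ ?_ ?_ ?_
  · intro n hn; simp only [mem_range, mem_Icc] at *; omega
  · intro n hn; simp only [mem_range, mem_Icc] at *; omega
  · intro n hn; simp
  · intro n hn; simp only [mem_Icc] at hn; omega
  · intro n hn; rfl

/-- The elementary symmetric function of the shifts `F (x + 1) - 1, …, F (x + h) - 1` is bounded
through Newton's identities by the first power sum, whose even moments have square root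
cancellation, and by the trivial bounds for the higher power sums. -/
theorem exists_abs_sum_truncSeries_le (k : ℕ) : ∃ C : ℝ, 0 ≤ C ∧ ∀ P : Finset ℕ,
    (∀ p ∈ P, p.Prime) → ∀ α : ℕ, 2 ≤ α → ∀ h : ℕ, 1 ≤ h →
    |∑ H ∈ (Icc (1 : ℤ) h).powersetCard k, ∑ T ∈ H.powerset,
        (-1 : ℝ) ^ (H \ T).card * truncSeries P α T| ≤
      2 ^ k * √h ^ k * (2 ^ k * ∏ p ∈ P, (1 + C / p) + 1 + (∏ p ∈ P, (1 + 6 / (p : ℝ))) ^ k) := by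
  obtain ⟨C, hC0, hC⟩ := exists_moment_le (2 * k)
  refine ⟨C, hC0, fun P hP α hα h hh => ?_⟩
  set N := ∏ p ∈ P, p ^ α with hN
  have hN0 : (0 : ℝ) < N := by exact_mod_cast prod_pow_pos hP α
  set K := ∏ p ∈ P, (1 + 6 / (p : ℝ)) with hK
  have hK0 : 0 ≤ K := Finset.prod_nonneg fun p _ => by positivity
  set G : ℤ → ℝ := fun y => ∏ p ∈ P, normInd α p y - 1 with hG
  set A : ℤ → ℝ := shiftSum h G with hA
  have hh1 : (1 : ℝ) ≤ h := by exact_mod_cast hh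
  have hs1 : 1 ≤ √h := Real.one_le_sqrt.2 hh1
  have hs0 : 0 < √(h : ℝ) := by linarith
  have hpow : ∀ x : ℤ, |∑ H ∈ (Icc (1 : ℤ) h).powersetCard k, ∏ t ∈ H, G (x + t)| ≤
      (|A x| + √h * K) ^ k := by
    intro x
    refine abs_sum_powersetCard_le (Icc (1 : ℤ) h) (fun t => G (x + t)) (fun j hj => ?_) k
    rcases Nat.eq_or_lt_of_le hj with rfl | hj2
    · simp only [pow_one]
      rw [sum_Icc_eq_shiftSum]
      have : 0 ≤ √h * K := by positivity
      linarith
    · have h1 : |∑ t ∈ Icc (1 : ℤ) h, G (x + t) ^ j| ≤ h * K ^ j := by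
        refine (Finset.abs_sum_le_sum_abs _ _).trans ?_
        calc ∑ t ∈ Icc (1 : ℤ) h, |G (x + t) ^ j| ≤ ∑ t ∈ Icc (1 : ℤ) h, K ^ j := by
              refine Finset.sum_le_sum fun t _ => ?_
              rw [abs_pow]
              exact pow_le_pow_left₀ (abs_nonneg _) (prod_normInd_le hP hα _) j
          _ = h * K ^ j := by simp
      have h2 : (h : ℝ) ≤ √h ^ j := by
        calc (h : ℝ) = √h ^ 2 := (Real.sq_sqrt (by positivity)).symm
          _ ≤ √h ^ j := pow_le_pow_right₀ hs1 hj2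
      calc _ ≤ h * K ^ j := h1
        _ ≤ √h ^ j * K ^ j := by gcongr
        _ = (√h * K) ^ j := (mul_pow _ _ _).symm
        _ ≤ (|A x| + √h * K) ^ j := by
            refine pow_le_pow_left₀ (by positivity) ?_ j
            linarith [abs_nonneg (A x)]
  -- `|A| ^ k` is traded for the even moment `A ^ (2 k)`, with weights balanced at `|A| = √h`
  have hsplit : ∀ x : ℤ, (|A x| + √h * K) ^ k ≤
      2 ^ k * (A x ^ (2 * k) / √h ^ k + √h ^ k + √h ^ k * K ^ k) := by
    intro x
    have hl : 0 < √(h : ℝ) ^ k := pow_pos hs0 k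
    have h1 : |A x| ^ k ≤ A x ^ (2 * k) / √h ^ k + √h ^ k := by
      have e : A x ^ (2 * k) = (|A x| ^ k) ^ 2 := by
        rw [← pow_mul, mul_comm k 2, pow_mul, pow_mul, sq_abs]
      rw [e]
      have h3 : |A x| ^ k ≤ ((|A x| ^ k) ^ 2 + (√h ^ k) ^ 2) / √h ^ k := by
        rw [le_div_iff₀ hl]
        nlinarith [sq_nonneg (|A x| ^ k - √(h : ℝ) ^ k), sq_nonneg (|A x| ^ k),
          sq_nonneg (√(h : ℝ) ^ k)]
      refine h3.trans_eq ?_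
      field_simp
    have h2 : (|A x| + √h * K) ^ k ≤ 2 ^ k * (|A x| ^ k + (√h * K) ^ k) := by
      refine (add_pow_le (abs_nonneg _) (by positivity) k).trans ?_
      refine mul_le_mul_of_nonneg_right ?_ (by positivity)
      exact pow_le_pow_right₀ one_le_two (Nat.sub_le k 1)
    rw [mul_pow] at h2
    refine h2.trans (mul_le_mul_of_nonneg_left ?_ (by positivity))
    linarith
  have hmain : N * ∑ H ∈ (Icc (1 : ℤ) h).powersetCard k, ∑ T ∈ H.powerset,
        (-1 : ℝ) ^ (H \ T).card * truncSeries P α T =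
      ∑ x ∈ range N, ∑ H ∈ (Icc (1 : ℤ) h).powersetCard k, ∏ t ∈ H, G (x + t) := by
    rw [Finset.mul_sum, Finset.sum_comm]
    exact Finset.sum_congr rfl fun H _ => (sum_prod_normInd_sub_one hP α H).symm
  have hmom := hC P hP α hα h
  refine le_of_mul_le_mul_left ?_ hN0
  rw [show ∀ y : ℝ, (N : ℝ) * |y| = |N * y| from fun y => by rw [abs_mul, abs_of_pos hN0], hmain]
  calc |∑ x ∈ range N, ∑ H ∈ (Icc (1 : ℤ) h).powersetCard k, ∏ t ∈ H, G (x + t)|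
      ≤ ∑ x ∈ range N, 2 ^ k * (A x ^ (2 * k) / √h ^ k + √h ^ k + √h ^ k * K ^ k) :=
        (Finset.abs_sum_le_sum_abs _ _).trans
          (Finset.sum_le_sum fun x _ => (hpow x).trans (hsplit x))
    _ = 2 ^ k * ((∑ x ∈ range N, A x ^ (2 * k)) / √h ^ k + N * √h ^ k + N * (√h ^ k * K ^ k)) := by
        rw [← Finset.mul_sum, Finset.sum_add_distrib, Finset.sum_add_distrib, ← Finset.sum_div]
        simp
    _ ≤ 2 ^ k * (N * (√(2 * h) ^ (2 * k) * ∏ p ∈ P, (1 + C / p)) / √h ^ k + N * √h ^ k +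
          N * (√h ^ k * K ^ k)) := by
        gcongr
        exact (le_abs_self _).trans hmom
    _ = _ := by
        have e1 : √(2 * h : ℝ) ^ (2 * k) = 2 ^ k * (√h ^ k * √h ^ k) := by
          rw [pow_mul, Real.sq_sqrt (by positivity), mul_pow, ← mul_pow √(h : ℝ),
            Real.mul_self_sqrt (by positivity)]
        rw [e1]
        field_simp

/-! ### Local densities, Euler factors and the tail of the singular series -/

open Filter Topology

theorem localDensity_nonneg (H : Finset ℤ) {p : ℕ} (hp : p.Prime) : 0 ≤ localDensity H p :=
  ge_of_tendsto' (tendsto_densityMod H hp) fun _ => densityMod_nonneg _ _ _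

theorem localDensity_le_one (H : Finset ℤ) {p : ℕ} (hp : p.Prime) : localDensity H p ≤ 1 :=
  le_of_tendsto' (tendsto_densityMod H hp) fun _ => densityMod_le_one _ _ _

theorem quarter_le_localDensity {p : ℕ} (hp : p.Prime) : 1 / 4 ≤ localDensity {0} p :=
  ge_of_tendsto (tendsto_densityMod {0} hp)
    ((eventually_ge_atTop 2).mono fun _ hα => quarter_le_densityMod hp hα)

theorem one_sub_inv_le_localDensity {p : ℕ} (hp : p.Prime) (h2 : p ≠ 2) :
    1 - 1 / (p : ℝ) ≤ localDensity {0} p :=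
  ge_of_tendsto (tendsto_densityMod {0} hp)
    ((eventually_ge_atTop 1).mono fun _ hα => one_sub_inv_le_densityMod hp h2 hα)

theorem inv_localDensity_le {p : ℕ} (hp : p.Prime) : (localDensity {0} p)⁻¹ ≤ 1 + 6 / p := by
  have h0 : localDensity {0} p ≠ 0 := by linarith [quarter_le_localDensity hp]
  exact le_of_tendsto ((tendsto_densityMod {0} hp).inv₀ h0)
    ((eventually_ge_atTop 2).mono fun _ hα => inv_densityMod_le hp hα)

theorem localDensity_eq_of_distinct {p : ℕ} (hp : p.Prime) (h2 : p ≠ 2) {H : Finset ℤ}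
    (hH : ∀ s ∈ H, ∀ t ∈ H, (p : ℤ) ∣ s - t → s = t) :
    localDensity H p = 1 - H.card * (1 - localDensity {0} p) := by
  refine tendsto_nhds_unique (tendsto_densityMod H hp) ?_
  simp only [densityMod_eq_of_distinct hp h2 hH]
  exact ((((tendsto_densityMod {0} hp).const_sub 1).const_mul _).const_sub 1)

theorem eulerFactor_nonneg (H : Finset ℤ) {p : ℕ} (hp : p.Prime) : 0 ≤ eulerFactor H p :=
  div_nonneg (localDensity_nonneg H hp) (pow_nonneg (localDensity_nonneg _ hp) _)

theorem eulerFactor_le (H : Finset ℤ) {p k : ℕ} (hp : p.Prime) (hk : H.card ≤ k) :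
    eulerFactor H p ≤ (1 + 6 / (p : ℝ)) ^ k := by
  have h0 : 0 ≤ 6 / (p : ℝ) := by positivity
  have h1 := inv_localDensity_le hp
  have h2 : 0 ≤ (localDensity {0} p)⁻¹ := inv_nonneg.2 (localDensity_nonneg _ hp)
  calc eulerFactor H p = localDensity H p * (localDensity {0} p)⁻¹ ^ H.card := by
        rw [eulerFactor, div_eq_mul_inv, inv_pow]
    _ ≤ 1 * (1 + 6 / (p : ℝ)) ^ H.card :=
        mul_le_mul (localDensity_le_one H hp) (pow_le_pow_left₀ h2 h1 _) (by positivity) one_pos.le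
    _ ≤ _ := by rw [one_mul]; exact pow_le_pow_right₀ (by linarith) hk

theorem abs_one_sub_mul_sub_pow_le {β : ℝ} (h0 : 0 ≤ β) (h1 : β ≤ 1) (k : ℕ) :
    |1 - k * β - (1 - β) ^ k| ≤ k ^ 2 * β ^ 2 := by
  have hlow : ∀ k : ℕ, 1 - k * β ≤ (1 - β) ^ k := fun k => by
    have := one_add_mul_le_pow (by linarith : -2 ≤ -β) k
    rw [← sub_eq_add_neg] at this
    linarith
  have hup : (1 - β) ^ k ≤ 1 - k * β + k ^ 2 * β ^ 2 := by
    induction k with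
    | zero => simp
    | succ k ih =>
      rw [pow_succ]
      have h3 := mul_le_mul_of_nonneg_right ih (by linarith : 0 ≤ 1 - β)
      have hk : (0 : ℝ) ≤ k := Nat.cast_nonneg k
      have h4 : 0 ≤ (k : ℝ) ^ 2 * β ^ 3 := by positivity
      have h5 : 0 ≤ (k + 1) * β ^ 2 := by positivity
      push_cast
      nlinarith
  rw [abs_le]
  constructor
  · linarith
  · have := hlow k
    have : 0 ≤ (k : ℝ) ^ 2 * β ^ 2 := by positivity
    linarith

theorem abs_eulerFactor_sub_one_le {p k : ℕ} (hp : p.Prime) (h2 : p ≠ 2) {H : Finset ℤ}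
    (hk : H.card ≤ k) (hH : ∀ s ∈ H, ∀ t ∈ H, (p : ℤ) ∣ s - t → s = t) :
    |eulerFactor H p - 1| ≤ 4 ^ k * k ^ 2 * ((p : ℝ) ^ 2)⁻¹ := by
  set δ := localDensity {0} p with hδ
  have hq : 1 / 4 ≤ δ := quarter_le_localDensity hp
  have hδ0 : 0 < δ := by linarith
  have hδ1 : δ ≤ 1 := localDensity_le_one _ hp
  have hβ : 1 - δ ≤ 1 / (p : ℝ) := by linarith [one_sub_inv_le_localDensity hp h2]
  have hpow : 0 < δ ^ H.card := pow_pos hδ0 _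
  have h3 := abs_one_sub_mul_sub_pow_le (by linarith : 0 ≤ 1 - δ) (by linarith) H.card
  rw [sub_sub_cancel] at h3
  have hinv : (δ ^ H.card)⁻¹ ≤ 4 ^ k := by
    rw [← inv_pow]
    have : δ⁻¹ ≤ 4 := by
      rw [inv_le_comm₀ hδ0 (by norm_num)]; linarith
    exact (pow_le_pow_left₀ (inv_nonneg.2 hδ0.le) this _).trans
      (pow_le_pow_right₀ (by norm_num) hk)
  have hk2 : ((H.card : ℝ)) ^ 2 ≤ (k : ℝ) ^ 2 := by
    have : (H.card : ℝ) ≤ k := by exact_mod_cast hk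
    gcongr
  have e : eulerFactor H p - 1 = (1 - H.card * (1 - δ) - δ ^ H.card) * (δ ^ H.card)⁻¹ := by
    rw [eulerFactor, localDensity_eq_of_distinct hp h2 hH, ← hδ]
    field_simp
  have hβ2 : (1 - δ) ^ 2 ≤ ((p : ℝ) ^ 2)⁻¹ := by
    have := pow_le_pow_left₀ (by linarith : 0 ≤ 1 - δ) hβ 2
    simpa using this
  rw [e, abs_mul, abs_of_pos (inv_pos.2 hpow)]
  calc |1 - H.card * (1 - δ) - δ ^ H.card| * (δ ^ H.card)⁻¹
      ≤ ((k : ℝ) ^ 2 * ((p : ℝ) ^ 2)⁻¹) * 4 ^ k := by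
        refine mul_le_mul (h3.trans ?_) hinv (inv_nonneg.2 hpow.le) (by positivity)
        exact mul_le_mul hk2 hβ2 (sq_nonneg _) (by positivity)
    _ = _ := by ring

theorem eq_of_dvd_sub_of_bounded {p : ℕ} {M : ℤ} {s t : ℤ} (hp : M < p) (hst : |s - t| ≤ M)
    (h : (p : ℤ) ∣ s - t) : s = t :=
  sub_eq_zero.1 (Int.eq_zero_of_abs_lt_dvd h (by omega))

theorem multipliable_eulerFactor (H : Finset ℤ) :
    Multipliable fun p : PrimeNotOneModFour => eulerFactor H p := by
  obtain ⟨M, hM⟩ : ∃ M : ℕ, ∀ s ∈ H, ∀ t ∈ H, |s - t| ≤ (M : ℤ) := by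
    refine ⟨∑ s ∈ H, s.natAbs + ∑ s ∈ H, s.natAbs, fun s hs t ht => ?_⟩
    have h1 := Finset.single_le_sum (f := fun s : ℤ => s.natAbs) (fun _ _ => Nat.zero_le _) hs
    have h2 := Finset.single_le_sum (f := fun s : ℤ => s.natAbs) (fun _ _ => Nat.zero_le _) ht
    rw [abs_le]; omega
  have hs : Summable fun p : PrimeNotOneModFour =>
      (4 : ℝ) ^ H.card * (H.card : ℝ) ^ 2 * (((p : ℕ) : ℝ) ^ 2)⁻¹ :=
    ((Real.summable_nat_pow_inv.2 one_lt_two).comp_injective Subtype.val_injective).mul_left _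
  have hfin : Set.Finite {p : PrimeNotOneModFour | (p : ℕ) ≤ M + 2} :=
    (Set.finite_le_nat (M + 2)).preimage Subtype.val_injective.injOn
  have hs2 : Summable fun p : PrimeNotOneModFour => ‖eulerFactor H p - 1‖ := by
    refine Summable.of_norm_bounded_eventually hs ?_
    filter_upwards [hfin.compl_mem_cofinite] with p hp
    have hp' : M + 2 < (p : ℕ) := by simpa using hp
    rw [norm_norm, Real.norm_eq_abs]
    exact abs_eulerFactor_sub_one_le p.2.1 (by omega) le_rfl fun s hs t ht =>
      eq_of_dvd_sub_of_bounded (M := M) (by omega) (hM s hs t ht)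
  have := multipliable_one_add_of_summable hs2
  simpa using this

/-- The primes up to `y` that are not `1` modulo `4`. -/
def primesUpTo (y : ℕ) : Finset PrimeNotOneModFour :=
  (range (y + 1)).subtype fun p => p.Prime ∧ ¬ p ≡ 1 [MOD 4]

theorem mem_primesUpTo {y : ℕ} {p : PrimeNotOneModFour} : p ∈ primesUpTo y ↔ (p : ℕ) ≤ y := by
  simp [primesUpTo, Finset.mem_subtype]

theorem sum_inv_sq_le {y : ℕ} (Q : Finset PrimeNotOneModFour) (hQ : ∀ p ∈ Q, y < (p : ℕ)) :
    ∑ p ∈ Q, (((p : ℕ) : ℝ) ^ 2)⁻¹ ≤ 2 / (y + 1) := by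
  set R := Q.map (Embedding.subtype _) with hR
  have h1 : ∑ p ∈ Q, (((p : ℕ) : ℝ) ^ 2)⁻¹ = ∑ n ∈ R, ((n : ℝ) ^ 2)⁻¹ := by
    rw [hR, Finset.sum_map]; rfl
  rw [h1]
  refine le_trans ?_ (sum_Ioo_inv_sq_le y (R.sup id + 1))
  refine Finset.sum_le_sum_of_subset_of_nonneg ?_ fun _ _ _ => by positivity
  intro n hn
  rw [mem_Ioo]
  refine ⟨?_, Nat.lt_succ_of_le (Finset.le_sup (f := id) hn)⟩
  obtain ⟨p, hp, rfl⟩ := Finset.mem_map.1 hn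
  exact hQ p hp

/-- Truncating the Euler product of the singular series of a subset of `{1, …, h}` at `y ≥ h`. -/
theorem exists_abs_singularSeries_sub_le (k : ℕ) : ∃ D : ℝ, 0 ≤ D ∧ ∀ h y : ℕ, h ≤ y → 2 ≤ y →
    ∀ T : Finset ℤ, T ⊆ Icc (1 : ℤ) h → T.card ≤ k →
    |singularSeries T - ∏ p ∈ primesUpTo y, eulerFactor T p| ≤
      D * (∏ p ∈ primesUpTo y, (1 + 6 / ((p : ℕ) : ℝ))) ^ k / y := by
  set c : ℝ := 4 ^ k * k ^ 2 with hc
  have hc0 : 0 ≤ c := by positivity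
  refine ⟨2 * c * Real.exp (2 * c), by positivity, fun h y hhy hy T hT hk => ?_⟩
  have hy0 : (0 : ℝ) < y := by exact_mod_cast (by omega : 0 < y)
  have hy1 : (1 : ℝ) ≤ y := by exact_mod_cast (by omega : 1 ≤ y)
  set E := ∏ p ∈ primesUpTo y, eulerFactor T p with hE
  set K := ∏ p ∈ primesUpTo y, (1 + 6 / ((p : ℕ) : ℝ)) with hK
  have hE0 : 0 ≤ E := Finset.prod_nonneg fun p _ => eulerFactor_nonneg T p.2.1
  have hEK : E ≤ K ^ k := by
    rw [hK, ← Finset.prod_pow]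
    exact Finset.prod_le_prod (fun p _ => eulerFactor_nonneg T p.2.1)
      fun p _ => eulerFactor_le T p.2.1 hk
  have htail : ∀ Q : Finset PrimeNotOneModFour, primesUpTo y ⊆ Q →
      |∏ p ∈ Q, eulerFactor T p - E| ≤ 2 * c * Real.exp (2 * c) * K ^ k / y := by
    intro Q hQ
    have hmem : ∀ p ∈ Q \ primesUpTo y, y < (p : ℕ) := by
      intro p hp
      rw [Finset.mem_sdiff, mem_primesUpTo] at hp
      omega
    have h1 : ∑ p ∈ Q \ primesUpTo y, ‖eulerFactor T p - 1‖ ≤ 2 * c / y := by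
      calc ∑ p ∈ Q \ primesUpTo y, ‖eulerFactor T p - 1‖
          ≤ ∑ p ∈ Q \ primesUpTo y, c * (((p : ℕ) : ℝ) ^ 2)⁻¹ := by
            refine Finset.sum_le_sum fun p hp => ?_
            have hpy := hmem p hp
            refine abs_eulerFactor_sub_one_le p.2.1 (by omega) hk fun s hs t ht =>
              eq_of_dvd_sub_of_bounded (M := y) (by omega) ?_
            have h1 := mem_Icc.1 (hT hs)
            have h2 := mem_Icc.1 (hT ht)
            rw [abs_le]; omega
        _ ≤ c * (2 / (y + 1)) := by
            rw [← Finset.mul_sum]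
            exact mul_le_mul_of_nonneg_left (sum_inv_sq_le _ hmem) hc0
        _ ≤ c * (2 / y) := by gcongr; linarith
        _ = 2 * c / y := by ring
    have h2 := Finset.norm_prod_one_add_sub_one_le (Q \ primesUpTo y)
      fun p : PrimeNotOneModFour => eulerFactor T p - 1
    simp only [add_sub_cancel] at h2
    have h3 : Real.exp (∑ p ∈ Q \ primesUpTo y, ‖eulerFactor T p - 1‖) - 1 ≤
        2 * c / y * Real.exp (2 * c) := by
      set S := ∑ p ∈ Q \ primesUpTo y, ‖eulerFactor T p - 1‖ with hS
      have hS0 : 0 ≤ S := Finset.sum_nonneg fun _ _ => norm_nonneg _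
      have hS2 : S ≤ 2 * c := h1.trans (div_le_self (by positivity) hy1)
      have h4 : Real.exp S - 1 ≤ S * Real.exp S := by
        have h5 := Real.add_one_le_exp (-S)
        have h6 : Real.exp S * Real.exp (-S) = 1 := by rw [← Real.exp_add]; simp
        nlinarith [Real.exp_pos S]
      exact h4.trans (mul_le_mul h1 (Real.exp_le_exp.2 hS2) (Real.exp_pos _).le (by positivity))
    rw [← Finset.prod_sdiff hQ, show ∀ z : ℝ, z * E - E = (z - 1) * E from fun z => by ring,
      abs_mul, abs_of_nonneg hE0]
    calc _ ≤ (2 * c / y * Real.exp (2 * c)) * K ^ k :=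
          mul_le_mul (h2.trans h3) hEK hE0 (by positivity)
      _ = _ := by ring
  have hlim : Tendsto (fun Q : Finset PrimeNotOneModFour => |∏ p ∈ Q, eulerFactor T p - E|) atTop
      (𝓝 |singularSeries T - E|) :=
    (((multipliable_eulerFactor T).hasProd).sub_const E).abs
  exact le_of_tendsto hlim ((eventually_ge_atTop (primesUpTo y)).mono htail)

/-! ### The sum over all subsets -/

/-- The truncation at `y` is made before the levels `p ^ α` tend to infinity, since the truncated
bound does not depend on `α`. -/
theorem exists_abs_sum_singularSeries₀_le (k : ℕ) : ∃ C D : ℝ, 0 ≤ C ∧ 0 ≤ D ∧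
    ∀ h y : ℕ, 1 ≤ h → h ≤ y → 2 ≤ y → h ^ k ≤ y →
    |∑ H ∈ (Icc (1 : ℤ) h).powersetCard k, singularSeries₀ H| ≤
      2 ^ k * √h ^ k * (2 ^ k * ∏ p ∈ primesUpTo y, (1 + C / ((p : ℕ) : ℝ)) + 1 +
        (∏ p ∈ primesUpTo y, (1 + 6 / ((p : ℕ) : ℝ))) ^ k) +
      2 ^ k * D * (∏ p ∈ primesUpTo y, (1 + 6 / ((p : ℕ) : ℝ))) ^ k := by
  obtain ⟨C, hC0, hC⟩ := exists_abs_sum_truncSeries_le k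
  obtain ⟨D, hD0, hD⟩ := exists_abs_singularSeries_sub_le k
  refine ⟨C, D, hC0, hD0, fun h y hh hhy hy hky => ?_⟩
  have hy0 : (0 : ℝ) < y := by exact_mod_cast (by omega : 0 < y)
  set P : Finset ℕ := (primesUpTo y).map (Embedding.subtype _) with hPdef
  have hP : ∀ p ∈ P, p.Prime := by
    intro p hp
    obtain ⟨q, _, rfl⟩ := Finset.mem_map.1 hp
    exact q.2.1
  have hprod : ∀ f : ℕ → ℝ, ∏ p ∈ P, f p = ∏ p ∈ primesUpTo y, f p := fun f => by
    rw [hPdef, Finset.prod_map]; rfl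
  set K := ∏ p ∈ primesUpTo y, (1 + 6 / ((p : ℕ) : ℝ)) with hK
  have hK0 : 0 ≤ K := Finset.prod_nonneg fun p _ => by positivity
  set S : Finset ℤ → ℝ := fun T => ∏ p ∈ primesUpTo y, eulerFactor T p with hS
  set 𝓗 := (Icc (1 : ℤ) h).powersetCard k with h𝓗
  -- the bound for the truncated series is uniform in the modulus, hence survives in the limit
  have htrunc : |∑ H ∈ 𝓗, ∑ T ∈ H.powerset, (-1 : ℝ) ^ (H \ T).card * S T| ≤
      2 ^ k * √h ^ k * (2 ^ k * ∏ p ∈ primesUpTo y, (1 + C / ((p : ℕ) : ℝ)) + 1 + K ^ k) := by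
    have hlim : Tendsto (fun α : ℕ => |∑ H ∈ 𝓗, ∑ T ∈ H.powerset,
        (-1 : ℝ) ^ (H \ T).card * truncSeries P α T|) atTop
        (𝓝 |∑ H ∈ 𝓗, ∑ T ∈ H.powerset, (-1 : ℝ) ^ (H \ T).card * S T|) := by
      refine (tendsto_finsetSum _ fun H _ => tendsto_finsetSum _ fun T _ =>
        Tendsto.const_mul _ ?_).abs
      have : S T = ∏ p ∈ P, eulerFactor T p := (hprod fun p => eulerFactor T p).symm
      rw [this]
      refine tendsto_finsetProd _ fun p hp => ?_
      refine (tendsto_densityMod T (hP p hp)).div ((tendsto_densityMod {0} (hP p hp)).pow _) ?_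
      exact pow_ne_zero _ (by linarith [quarter_le_localDensity (hP p hp)])
    refine le_of_tendsto hlim ((eventually_ge_atTop 2).mono fun α hα => ?_)
    have := hC P hP α hα h hh
    rwa [hprod fun p => 1 + C / (p : ℝ), hprod fun p => 1 + 6 / (p : ℝ)] at this
  have htail : |∑ H ∈ 𝓗, singularSeries₀ H -
      ∑ H ∈ 𝓗, ∑ T ∈ H.powerset, (-1 : ℝ) ^ (H \ T).card * S T| ≤ 2 ^ k * D * K ^ k := by
    rw [← Finset.sum_sub_distrib]
    calc |∑ H ∈ 𝓗, (singularSeries₀ H - ∑ T ∈ H.powerset, (-1 : ℝ) ^ (H \ T).card * S T)|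
        ≤ ∑ H ∈ 𝓗, 2 ^ k * (D * K ^ k / y) := by
          refine (Finset.abs_sum_le_sum_abs _ _).trans (Finset.sum_le_sum fun H hH => ?_)
          obtain ⟨hHsub, hHk⟩ := Finset.mem_powersetCard.1 hH
          rw [singularSeries₀, ← Finset.sum_sub_distrib]
          calc |∑ T ∈ H.powerset, ((-1 : ℝ) ^ (H \ T).card * singularSeries T -
                (-1 : ℝ) ^ (H \ T).card * S T)|
              ≤ ∑ T ∈ H.powerset, D * K ^ k / y := by
                refine (Finset.abs_sum_le_sum_abs _ _).trans (Finset.sum_le_sum fun T hT => ?_)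
                have hTH := Finset.mem_powerset.1 hT
                rw [← mul_sub, abs_mul, abs_pow, abs_neg, abs_one, one_pow, one_mul]
                exact hD h y hhy hy T (hTH.trans hHsub) ((card_le_card hTH).trans_eq hHk)
            _ = 2 ^ k * (D * K ^ k / y) := by simp [hHk]
      _ = (𝓗.card : ℝ) / y * (2 ^ k * D * K ^ k) := by
          rw [Finset.sum_const, nsmul_eq_mul]; ring
      _ ≤ 1 * (2 ^ k * D * K ^ k) := by
          refine mul_le_mul_of_nonneg_right ((div_le_one hy0).2 ?_) (by positivity)
          have : 𝓗.card ≤ h ^ k := by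
            rw [h𝓗, card_powersetCard]; simpa using Nat.choose_le_pow h k
          exact_mod_cast this.trans hky
      _ = _ := one_mul _
  have e : ∑ H ∈ 𝓗, singularSeries₀ H =
      ∑ H ∈ 𝓗, ∑ T ∈ H.powerset, (-1 : ℝ) ^ (H \ T).card * S T +
      (∑ H ∈ 𝓗, singularSeries₀ H -
        ∑ H ∈ 𝓗, ∑ T ∈ H.powerset, (-1 : ℝ) ^ (H \ T).card * S T) := by ring
  rw [e]
  exact (abs_add_le _ _).trans (add_le_add htrunc htail)

theorem exists_sum_singularSeries₀_bound {k : ℕ} (hk : 1 ≤ k) {ε : ℝ} (hε : 0 < ε) :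
    ∃ C : ℝ, 0 < C ∧ ∀ h : ℕ, 1 ≤ h →
      |∑ H ∈ (Icc (1 : ℤ) h).powersetCard k, singularSeries₀ H| ≤
        C * (h : ℝ) ^ ((k : ℝ) / 2 + ε) := by
  have hk0 : (0 : ℝ) < k := by exact_mod_cast hk
  obtain ⟨C, D, hC0, hD0, hmain⟩ := exists_abs_sum_singularSeries₀_le k
  obtain ⟨C₁, hC₁0, hC₁⟩ := exists_prod_one_add_div_le hC0 (by positivity : 0 < ε / k)
  obtain ⟨C₂, hC₂0, hC₂⟩ := exists_prod_one_add_div_le (by norm_num : (0 : ℝ) ≤ 6)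
    (by positivity : 0 < ε / k / k)
  set B : ℝ := 2 ^ k * (2 ^ k * C₁ + 1 + C₂ ^ k) + 2 ^ k * D * C₂ ^ k with hB
  have hB0 : 0 < B := by positivity
  refine ⟨B * 2 ^ (ε / k), by positivity, fun h hh => ?_⟩
  have hh1 : (1 : ℝ) ≤ h := by exact_mod_cast hh
  have hh0 : (0 : ℝ) < h := by linarith
  have hhk : 1 ≤ h ^ k := Nat.one_le_pow _ _ hh
  have hhy : h ≤ h ^ k + 1 := (Nat.le_self_pow (by omega) h).trans (Nat.le_succ _)
  -- the `1` ensures that the primes beyond `y` are odd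
  set y := h ^ k + 1 with hy
  have hy1 : 1 ≤ y := by omega
  have hy1R : (1 : ℝ) ≤ y := by exact_mod_cast hy1
  have hprod : ∀ f : ℕ → ℝ, ∏ p ∈ primesUpTo y, f p =
      ∏ p ∈ (primesUpTo y).map (Embedding.subtype _), f p := fun f => by
    rw [Finset.prod_map]; rfl
  have hP : ∀ p ∈ (primesUpTo y).map (Embedding.subtype _), p.Prime := by
    intro p hp
    obtain ⟨q, _, rfl⟩ := Finset.mem_map.1 hp
    exact q.2.1
  have hPy : ∀ p ∈ (primesUpTo y).map (Embedding.subtype _), p ≤ y := by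
    intro p hp
    obtain ⟨q, hq, rfl⟩ := Finset.mem_map.1 hp
    exact mem_primesUpTo.1 hq
  have h1 := hC₁ y hy1 _ hP hPy
  have h2 := hC₂ y hy1 _ hP hPy
  rw [← hprod fun p => 1 + C / (p : ℝ)] at h1
  rw [← hprod fun p => 1 + 6 / (p : ℝ)] at h2
  set Y : ℝ := (y : ℝ) ^ (ε / k) with hY
  have hY1 : 1 ≤ Y := Real.one_le_rpow hy1R (by positivity)
  have h3 : (∏ p ∈ primesUpTo y, (1 + 6 / ((p : ℕ) : ℝ))) ^ k ≤ C₂ ^ k * Y := by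
    refine (pow_le_pow_left₀ (Finset.prod_nonneg fun p _ => by positivity) h2 k).trans_eq ?_
    rw [mul_pow, ← Real.rpow_natCast ((y : ℝ) ^ (ε / k / k)), ← Real.rpow_mul (by positivity),
      div_mul_cancel₀ _ hk0.ne']
  have hs1 : 1 ≤ √(h : ℝ) ^ k := one_le_pow₀ (Real.one_le_sqrt.2 hh1)
  have hYle : Y ≤ 2 ^ (ε / k) * (h : ℝ) ^ ε := by
    have e1 : (y : ℝ) ≤ 2 * (h : ℝ) ^ k := by
      have : y ≤ 2 * h ^ k := by omega
      exact_mod_cast this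
    calc Y ≤ (2 * (h : ℝ) ^ k) ^ (ε / k) :=
          Real.rpow_le_rpow (by positivity) e1 (by positivity)
      _ = 2 ^ (ε / k) * (h : ℝ) ^ ε := by
          rw [Real.mul_rpow (by norm_num) (by positivity), ← Real.rpow_natCast,
            ← Real.rpow_mul hh0.le, mul_div_cancel₀ _ hk0.ne']
  have hsqrt : √(h : ℝ) ^ k = (h : ℝ) ^ ((k : ℝ) / 2) := by
    rw [Real.sqrt_eq_rpow, ← Real.rpow_natCast, ← Real.rpow_mul hh0.le]
    congr 1; ring
  calc |∑ H ∈ (Icc (1 : ℤ) h).powersetCard k, singularSeries₀ H|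
      ≤ 2 ^ k * √h ^ k * (2 ^ k * ∏ p ∈ primesUpTo y, (1 + C / ((p : ℕ) : ℝ)) + 1 +
        (∏ p ∈ primesUpTo y, (1 + 6 / ((p : ℕ) : ℝ))) ^ k) +
      2 ^ k * D * (∏ p ∈ primesUpTo y, (1 + 6 / ((p : ℕ) : ℝ))) ^ k :=
        hmain h y hh hhy (by omega) (by omega)
    _ ≤ 2 ^ k * √h ^ k * (2 ^ k * (C₁ * Y) + Y + C₂ ^ k * Y) +
        2 ^ k * D * (√h ^ k * (C₂ ^ k * Y)) := by
        have h4 : C₂ ^ k * Y ≤ √h ^ k * (C₂ ^ k * Y) :=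
          le_mul_of_one_le_left (by positivity) hs1
        have h5 := h3.trans h4
        gcongr
    _ = B * √h ^ k * Y := by rw [hB]; ring
    _ ≤ B * √h ^ k * (2 ^ (ε / k) * (h : ℝ) ^ ε) := by gcongr
    _ = B * 2 ^ (ε / k) * (h : ℝ) ^ ((k : ℝ) / 2 + ε) := by
        rw [Real.rpow_add hh0, hsqrt]; ring

end SumTwoSquares

theorem theorem3p4 :
    (∀ (H : Finset ℤ) (p : ℕ), p.Prime →
      Filter.Tendsto (fun α : ℕ => SumTwoSquares.densityMod H p α) Filter.atTop
        (nhds (SumTwoSquares.localDensity H p))) ∧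
    (∀ H : Finset ℤ,
      Multipliable (fun p : SumTwoSquares.PrimeNotOneModFour =>
        SumTwoSquares.eulerFactor H p)) ∧
    ∀ k : ℕ, 1 ≤ k → ∀ ε : ℝ, 0 < ε → ∃ C : ℝ, 0 < C ∧ ∀ h : ℕ, 1 ≤ h →
      |∑ H ∈ (Finset.Icc (1 : ℤ) (h : ℤ)).powersetCard k, SumTwoSquares.singularSeries₀ H| ≤
        C * (h : ℝ) ^ ((k : ℝ) / 2 + ε) :=
  ⟨fun H _ hp => SumTwoSquares.tendsto_densityMod H hp, SumTwoSquares.multipliable_eulerFactor,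
    fun _ hk _ hε => SumTwoSquares.exists_sum_singularSeries₀_bound hk hε⟩
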